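/- Let $\mathcal I$ be a finite or countably infinite alphabet with at least two letters, let $A$ be an $\mathcal I\times\mathcal I$ matrix with entries in $\{0,1\}$, let $\Sigma_A=\{\underline x=(x_0,x_1,\dots)\in\mathcal I^{\mathbb N_0}: A_{x_i,x_{i+1}}=1 \text{ for all } i\ge 0\}$, and let $\sigma$ be the left shift on $\Sigma_A$. Write $C_k(\underline x)=\{\underline y\in\Sigma_A: y_i=x_i,\ 0\le i<k\}$, let $\mathcal C_k$ be the set of these $k$-cylinders, and let $[a]=\{\underline y\in\Sigma_A: y_0=a\}$. Assume that $(\Sigma_A,\sigma)$ is topologically mixing: for all $a,b\in\mathcal I$ there is $n_0$ such that $[a]\cap\sigma^{-n}[b]\ne\emptyset$ for all $n>n_0$. Let $\phi:\Sigma_A\to\mathbb R$ be locally Hölder, i.e. there are $M_\phi>0$ and $\zeta\in(0,1)$ such that $|\phi(\underline x)-\phi(\underline y)|\le M_\phi\zeta^k$ whenever $k\ge1$ and $x_i=y_i$ for all $0\le i<k$. Let $\mu$ be a Gibbs measure for $\phi$, i.e. a $\sigma$-invariant Borel probability measure on $\Sigma_A$ for which there are $c>0$ and $P\in\mathbb R$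 with $$c^{-1}\le\frac{\mu(C_m(\underline x))}{\exp\left(-mP+\sum_{i=0}^{m-1}\phi(\sigma^i\underline x)\right)}\le c\qquad\text{for all } m\ge1,\ \underline x\in\Sigma_A.$$ Then the Rényi (collision) entropy $$H_2(\mu)=\lim_{n\to\infty}\frac{1}{-n}\log\sum_{C\in\mathcal C_n}\mu(C)^2$$ exists and is finite and strictly positive, and for $\mu$-almost every $\underline x\in\Sigma_A$ the maximum $$M_n(\underline x)=\max\{k:\ \exists\, 0\le i<j\le n-1:\ x_i,\dots,x_{i+k-1}=x_j,\dots,x_{j+k-1}\}$$ exists for every $n\ge2$ and $$\lim_{n\to\infty}\frac{M_n(\underline x)}{\log n}=\frac{2}{H_2(\mu)}.$$ -/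

import Mathlib

open MeasureTheory Filter Topology

namespace MarkovShift

/-- The one-sided shift space `Σ_A` over the alphabet `I` with 0-1 transition matrix `A`:
sequences `x₀ x₁ x₂ …` all of whose transitions are allowed. -/
def ShiftSpace {I : Type*} (A : Matrix I I (Fin 2)) : Type _ :=
  {x : ℕ → I // ∀ i, A (x i) (x (i + 1)) = 1}

/-- The left shift `σ (x₀, x₁, …) = (x₁, x₂, …)`. -/
def shift {I : Type*} (A : Matrix I I (Fin 2)) (x : ShiftSpace A) : ShiftSpace A :=
  ⟨fun i => x.1 (i + 1), fun i => x.2 (i + 1)⟩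

/-- `C_k(x) = [x₀, …, x_{k-1}]`, the `k`-cylinder containing `x`. -/
def cylinder {I : Type*} {A : Matrix I I (Fin 2)} (k : ℕ) (x : ShiftSpace A) :
    Set (ShiftSpace A) :=
  {y | ∀ i < k, y.1 i = x.1 i}

/-- The one-letter cylinder `[a]`, possibly empty. -/
def letterCylinder {I : Type*} (A : Matrix I I (Fin 2)) (a : I) : Set (ShiftSpace A) :=
  {y | y.1 0 = a}

/-- The collection of all (nonempty) `k`-cylinders. -/
def cylinders {I : Type*} (A : Matrix I I (Fin 2)) (k : ℕ) : Set (Set (ShiftSpace A)) :=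
  Set.range (cylinder (A := A) k)

/-- The σ-algebra generated by the cylinders. For a countable alphabet every open set of the
symbolic metric is a countable union of cylinders, so this is the Borel σ-algebra. -/
instance instMeasurableSpaceShiftSpace {I : Type*} (A : Matrix I I (Fin 2)) :
    MeasurableSpace (ShiftSpace A) :=
  MeasurableSpace.generateFrom (⋃ k, cylinders A k)

/-- Topological mixing: for all letters `a, b`, `[a] ∩ σ⁻ⁿ[b] ≠ ∅` for all large `n`. -/
def TopologicallyMixing {I : Type*} (A : Matrix I I (Fin 2)) : Prop :=
  ∀ a b : I, ∃ n₀ : ℕ, ∀ n > n₀,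
    (letterCylinder A a ∩ (shift A)^[n] ⁻¹' letterCylinder A b).Nonempty

/-- Locally Hölder potentials: `var_k φ ≤ M ζ ^ k` for all `k ≥ 1`, where `var_k φ` is the
supremum of `|φ x - φ y|` over `x, y` that agree in their first `k` symbols. -/
def LocallyHolder {I : Type*} {A : Matrix I I (Fin 2)} (φ : ShiftSpace A → ℝ) : Prop :=
  ∃ M > (0 : ℝ), ∃ ζ ∈ Set.Ioo (0 : ℝ) 1, ∀ k ≥ 1, ∀ x y : ShiftSpace A,
    (∀ i < k, x.1 i = y.1 i) → |φ x - φ y| ≤ M * ζ ^ k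

/-- `μ` is a (shift-invariant, probability) Gibbs measure for the potential `φ`;
`birkhoffSum (shift A) φ m x` is `S_m φ (x) = ∑_{i < m} φ (σ^i x)`. -/
structure IsGibbs {I : Type*} {A : Matrix I I (Fin 2)} (φ : ShiftSpace A → ℝ)
    (μ : Measure (ShiftSpace A)) : Prop where
  isProbabilityMeasure : IsProbabilityMeasure μ
  invariant : MeasurePreserving (shift A) μ μ
  gibbs : ∃ c > (0 : ℝ), ∃ P : ℝ, ∀ m ≥ 1, ∀ x : ShiftSpace A,
    c⁻¹ ≤ μ.real (cylinder m x) / Real.exp (-(m * P) + birkhoffSum (shift A) φ m x) ∧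
    μ.real (cylinder m x) / Real.exp (-(m * P) + birkhoffSum (shift A) φ m x) ≤ c

/-- `Z_n(1) = ∑ μ(C)²`, the sum being over all `n`-cylinders `C`. -/
noncomputable def collisionSum {I : Type*} {A : Matrix I I (Fin 2)}
    (μ : Measure (ShiftSpace A)) (n : ℕ) : ℝ :=
  ∑' C : cylinders A n, μ.real (C : Set (ShiftSpace A)) ^ 2

/-- The Rényi entropy `H₂(μ) = lim log Z_n(1) / (-n)` exists and equals `H`. -/
def HasRenyiEntropy {I : Type*} {A : Matrix I I (Fin 2)}
    (μ : Measure (ShiftSpace A)) (H : ℝ) : Prop :=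
  Tendsto (fun n : ℕ => Real.log (collisionSum μ n) / (-(n : ℝ))) atTop (𝓝 H)

/-- The lengths `k` for which `x_i … x_{i+k-1} = x_j … x_{j+k-1}` for some
`0 ≤ i < j ≤ n - 1`. -/
def repeatLengths {I : Type*} {A : Matrix I I (Fin 2)} (x : ShiftSpace A) (n : ℕ) : Set ℕ :=
  {k | ∃ i j : ℕ, i < j ∧ j < n ∧ ∀ l < k, x.1 (i + l) = x.1 (j + l)}

/-- `M_n(x)`, the maximum of `repeatLengths x n` (where it exists). -/
noncomputable def maxRepeat {I : Type*} {A : Matrix I I (Fin 2)} (x : ShiftSpace A) (n : ℕ) : ℕ :=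
  sSup (repeatLengths x n)

end MarkovShift

/-!
Everything rests on the quasi-Bernoulli property `QuasiBernoulli` of Gibbs measures: since Birkhoff
sums are additive, the measure of the cylinder of a concatenated word `uv` is `μ[u] μ[v]` up to a
constant factor. For events determined by finitely many symbols this gives the upper bound
`μ (B ∩ σ⁻ᵖ E) ≤ K μ B μ E` when `E` starts after the end of `B` (`measure_inter_le`). The upper
bound forces every word to be continued, and to be preceded, by a letter of a fixed finite set
(`exists_finset_big_images`); together with mixing, this yields the matching lower bound
`μ B μ E ≤ L μ (B ∩ σ⁻ᵖ E)` beyond a fixed gap (`exists_gap`). These two inequalities take the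
place of any finer decay of correlations.

*Entropy.* With `Z_n = ∑ μ(C)²`, the upper bound gives `Z_{m+n} ≤ K² Z_m Z_n`, so Fekete's lemma
applies. The sequence is not superexponentially small because words can be continued within the
finite set of letters, and its rate is positive because beyond the gap two different letters both
have a definite conditional probability, so that the cylinders shrink exponentially.

*Upper bound for `M_n`.* The expected number of repetitions of length `k` among `n` positions is at
most of order `n² Z_k + n k Z_{k/2}`. The second term accounts for overlapping repetitions: these are
periodic words, which contain a repetition of length `k / 2` without overlap. For
`n = exp (a k / 2)` with `a < H` this is summable in `k`, and the Borel–Cantelli lemma applies.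

*Lower bound for `M_n`.* If `N² Z_k ≥ 1`, the second moment method shows that `N` early and `N` late
words of length `k`, read at distance at least the gap from each other, contain a common word with
probability bounded away from zero, uniformly in `k` (`le_measureReal_match`). Decoupling only holds
up to constant factors, so this probability cannot be brought near one directly; instead `k`
successive blocks, separated by gaps, are tried, and all of them fail with probability exponentially
small in `k` (`measureReal_blocks_le`). For `a > H` all blocks fit into time `exp (a k / 2)`, and the
Borel–Cantelli lemma applies again. The two scales give `M_n ∼ (2 / H) log n` (`tendsto_maxRepeat_div_log`).
-/

namespace MarkovShift

open scoped ENNReal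

variable {I : Type*} {A : Matrix I I (Fin 2)}

/-! ### Cylinders and finitely determined sets -/

/-- `E` depends on the first `n` symbols only: membership is inherited by every point with the same
first `n` symbols. -/
def DeterminedBy (n : ℕ) (E : Set (ShiftSpace A)) : Prop :=
  ∀ x y : ShiftSpace A, (∀ i < n, y.1 i = x.1 i) → x ∈ E → y ∈ E

theorem shift_iterate_apply (x : ShiftSpace A) (n i : ℕ) :
    ((shift A)^[n] x).1 i = x.1 (n + i) := by
  induction n generalizing x with
  | zero => simp
  | succ n ih =>
    rw [Function.iterate_succ_apply, ih]
    exact congrArg x.1 (by omega : n + i + 1 = n + 1 + i)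

theorem mem_cylinder_self (k : ℕ) (x : ShiftSpace A) : x ∈ cylinder k x := fun _ _ => rfl

theorem cylinder_mem (k : ℕ) (x : ShiftSpace A) : cylinder k x ∈ cylinders A k := ⟨x, rfl⟩

theorem cylinder_eq_of_mem {k : ℕ} {x y : ShiftSpace A} (h : y ∈ cylinder k x) :
    cylinder k y = cylinder k x := by
  ext z
  exact ⟨fun hz i hi => (hz i hi).trans (h i hi), fun hz i hi => (hz i hi).trans (h i hi).symm⟩

theorem eq_cylinder_of_mem {k : ℕ} {C : Set (ShiftSpace A)} (hC : C ∈ cylinders A k)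
    {x : ShiftSpace A} (hx : x ∈ C) : C = cylinder k x := by
  obtain ⟨y, rfl⟩ := hC
  exact (cylinder_eq_of_mem hx).symm

theorem cylinder_zero (x : ShiftSpace A) : cylinder 0 x = Set.univ := by
  ext y; simp [cylinder]

theorem cylinder_one (x : ShiftSpace A) : cylinder 1 x = letterCylinder A (x.1 0) := by
  ext y; simp [cylinder, letterCylinder]

theorem cylinder_add (m n : ℕ) (x : ShiftSpace A) :
    cylinder (m + n) x = cylinder m x ∩ (shift A)^[m] ⁻¹' cylinder n ((shift A)^[m] x) := by
  ext y
  simp only [cylinder, Set.mem_ofPred_eq, Set.mem_inter_iff, Set.mem_preimage, shift_iterate_apply]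
  refine ⟨fun h => ⟨fun i hi => h i (by omega), fun i hi => h _ (by omega)⟩, fun h i hi => ?_⟩
  by_cases him : i < m
  · exact h.1 i him
  · have := h.2 (i - m) (by omega)
    rwa [show m + (i - m) = i by omega] at this

theorem cylinders_pairwiseDisjoint (k : ℕ) :
    Pairwise (Function.onFun Disjoint fun C : cylinders A k => (C : Set (ShiftSpace A))) := by
  intro C D hCD
  rw [Function.onFun, Set.disjoint_left]
  intro x hC hD
  exact hCD (Subtype.ext ((eq_cylinder_of_mem C.2 hC).trans (eq_cylinder_of_mem D.2 hD).symm))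

theorem iUnion_cylinders (k : ℕ) :
    ⋃ C : cylinders A k, (C : Set (ShiftSpace A)) = Set.univ :=
  Set.eq_univ_of_forall fun x =>
    Set.mem_iUnion.2 ⟨⟨cylinder k x, cylinder_mem k x⟩, mem_cylinder_self k x⟩

instance countable_cylinders [Countable I] (k : ℕ) : Countable (cylinders A k) := by
  have hrep : ∀ C : cylinders A k, ∃ x, cylinder k x = (C : Set (ShiftSpace A)) := fun C => C.2
  choose r hr using hrep
  refine Function.Injective.countable
    (f := fun C : cylinders A k => fun i : Fin k => (r C).1 i) fun C D h => Subtype.ext ?_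
  rw [← hr C, ← hr D]
  exact cylinder_eq_of_mem fun i hi => congrFun h ⟨i, hi⟩

theorem measurableSet_of_mem_cylinders {k : ℕ} {C : Set (ShiftSpace A)}
    (hC : C ∈ cylinders A k) : MeasurableSet C :=
  MeasurableSpace.measurableSet_generateFrom (Set.mem_iUnion.2 ⟨k, hC⟩)

namespace DeterminedBy

theorem mono {m n : ℕ} (hmn : m ≤ n) {E : Set (ShiftSpace A)} (hE : DeterminedBy m E) :
    DeterminedBy n E := fun x y h => hE x y fun i hi => h i (by omega)

theorem inter {n : ℕ} {E F : Set (ShiftSpace A)} (hE : DeterminedBy n E)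
    (hF : DeterminedBy n F) : DeterminedBy n (E ∩ F) :=
  fun x y h hx => ⟨hE x y h hx.1, hF x y h hx.2⟩

theorem preimage (m : ℕ) {n : ℕ} {E : Set (ShiftSpace A)} (hE : DeterminedBy n E) :
    DeterminedBy (m + n) ((shift A)^[m] ⁻¹' E) := by
  intro x y h hx
  refine hE _ _ (fun i hi => ?_) hx
  rw [shift_iterate_apply, shift_iterate_apply]
  exact h _ (by omega)

theorem of_mem_cylinders {n : ℕ} {C : Set (ShiftSpace A)} (hC : C ∈ cylinders A n) :
    DeterminedBy n C := by
  obtain ⟨z, rfl⟩ := hC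
  exact fun x y h hx i hi => (h i hi).trans (hx i hi)

theorem subset_or_disjoint {n : ℕ} {E C : Set (ShiftSpace A)} (hE : DeterminedBy n E)
    (hC : C ∈ cylinders A n) : C ⊆ E ∨ E ∩ C = ∅ := by
  by_cases h : (E ∩ C).Nonempty
  · obtain ⟨x, hxE, hxC⟩ := h
    left
    rw [eq_cylinder_of_mem hC hxC]
    exact fun y hy => hE x y hy hxE
  · exact Or.inr (Set.not_nonempty_iff_eq_empty.1 h)

theorem measurableSet [Countable I] {n : ℕ} {E : Set (ShiftSpace A)} (hE : DeterminedBy n E) :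
    MeasurableSet E := by
  have : E = ⋃ C : cylinders A n, E ∩ (C : Set (ShiftSpace A)) := by
    rw [← Set.inter_iUnion, iUnion_cylinders, Set.inter_univ]
  rw [this]
  refine MeasurableSet.iUnion fun C => ?_
  rcases hE.subset_or_disjoint C.2 with h | h
  · rw [Set.inter_eq_right.2 h]
    exact measurableSet_of_mem_cylinders C.2
  · rw [h]
    exact MeasurableSet.empty

end DeterminedBy

theorem determinedBy_letter (a : I) : DeterminedBy 1 (letterCylinder A a) :=
  fun _ _ h hx => (h 0 one_pos).trans hx

theorem measure_eq_tsum_cylinders [Countable I] (μ : Measure (ShiftSpace A)) (k : ℕ)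
    (S : Set (ShiftSpace A)) (hS : MeasurableSet S) :
    μ S = ∑' C : cylinders A k, μ (S ∩ C) := by
  rw [← measure_iUnion, ← Set.inter_iUnion, iUnion_cylinders, Set.inter_univ]
  · intro C D h
    exact (cylinders_pairwiseDisjoint k h).mono Set.inter_subset_right Set.inter_subset_right
  · exact fun C => hS.inter (measurableSet_of_mem_cylinders C.2)

theorem measurable_shift_iterate [Countable I] (m : ℕ) :
    Measurable ((shift A)^[m]) := by
  refine measurable_generateFrom fun C hC => ?_
  obtain ⟨n, hC⟩ := Set.mem_iUnion.1 hC
  exact ((DeterminedBy.of_mem_cylinders hC).preimage m).measurableSet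

/-- Splitting along cylinders in the past and in the future. -/
theorem measure_inter_preimage_eq_tsum [Countable I] (μ : Measure (ShiftSpace A)) (m n p : ℕ)
    {B E : Set (ShiftSpace A)} (hB : DeterminedBy m B) (hE : DeterminedBy n E) :
    μ (B ∩ (shift A)^[p] ⁻¹' E) =
      ∑' C : cylinders A m, ∑' D : cylinders A n,
        μ ((B ∩ C) ∩ (shift A)^[p] ⁻¹' (E ∩ D)) := by
  have hBE : MeasurableSet (B ∩ (shift A)^[p] ⁻¹' E) :=
    hB.measurableSet.inter (hE.preimage p).measurableSet
  rw [measure_eq_tsum_cylinders μ m _ hBE]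
  congr 1
  ext C
  have hS := hBE.inter (measurableSet_of_mem_cylinders C.2)
  have hd : Pairwise (Function.onFun Disjoint
      fun D : cylinders A n => (shift A)^[p] ⁻¹' (D : Set (ShiftSpace A))) :=
    fun D D' h => (cylinders_pairwiseDisjoint n h).preimage _
  have hu : ⋃ D : cylinders A n, (shift A)^[p] ⁻¹' (D : Set (ShiftSpace A)) = Set.univ := by
    rw [← Set.preimage_iUnion, iUnion_cylinders, Set.preimage_univ]
  rw [← measure_iUnion]
  · congr 1
    ext x
    have hx : ∃ D : cylinders A n, (shift A)^[p] x ∈ (D : Set (ShiftSpace A)) := by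
      have := Set.mem_univ x
      rw [← hu] at this
      simpa using this
    obtain ⟨D, hD⟩ := hx
    simp only [Set.mem_iUnion, Set.mem_inter_iff, Set.mem_preimage]
    constructor
    · rintro ⟨⟨h1, h2⟩, h3⟩
      exact ⟨D, ⟨h1, h3⟩, h2, hD⟩
    · rintro ⟨D', ⟨h1, h3⟩, h2, -⟩
      exact ⟨⟨h1, h2⟩, h3⟩
  · intro D D' h
    exact (hd h).mono (fun x hx => hx.2.2) (fun x hx => hx.2.2)
  · intro D
    exact ((hB.measurableSet.inter (measurableSet_of_mem_cylinders C.2))).inter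
      (((hE.inter (DeterminedBy.of_mem_cylinders D.2)).preimage p).measurableSet)

theorem measure_inter_preimage_le [Countable I] {μ : Measure (ShiftSpace A)} {m n p : ℕ}
    {K : ℝ≥0∞}
    (h : ∀ C ∈ cylinders A m, ∀ D ∈ cylinders A n, μ (C ∩ (shift A)^[p] ⁻¹' D) ≤ K * (μ C * μ D))
    {B E : Set (ShiftSpace A)} (hB : DeterminedBy m B) (hE : DeterminedBy n E) :
    μ (B ∩ (shift A)^[p] ⁻¹' E) ≤ K * (μ B * μ E) := by
  rw [measure_inter_preimage_eq_tsum μ m n p hB hE, measure_eq_tsum_cylinders μ m B hB.measurableSet,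
    measure_eq_tsum_cylinders μ n E hE.measurableSet, ← ENNReal.tsum_mul_right,
    ← ENNReal.tsum_mul_left]
  refine ENNReal.tsum_le_tsum fun C => ?_
  rw [← ENNReal.tsum_mul_left, ← ENNReal.tsum_mul_left]
  refine ENNReal.tsum_le_tsum fun D => ?_
  rcases hB.subset_or_disjoint C.2 with hC | hC
  · rcases hE.subset_or_disjoint D.2 with hD | hD
    · rw [Set.inter_eq_right.2 hC, Set.inter_eq_right.2 hD]
      exact h C C.2 D D.2
    · simp [hD]
  · simp [hC]

theorem measure_mul_le_inter_preimage [Countable I] {μ : Measure (ShiftSpace A)} {m n p : ℕ}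
    {K : ℝ≥0∞}
    (h : ∀ C ∈ cylinders A m, ∀ D ∈ cylinders A n, μ C * μ D ≤ K * μ (C ∩ (shift A)^[p] ⁻¹' D))
    {B E : Set (ShiftSpace A)} (hB : DeterminedBy m B) (hE : DeterminedBy n E) :
    μ B * μ E ≤ K * μ (B ∩ (shift A)^[p] ⁻¹' E) := by
  rw [measure_inter_preimage_eq_tsum μ m n p hB hE, measure_eq_tsum_cylinders μ m B hB.measurableSet,
    measure_eq_tsum_cylinders μ n E hE.measurableSet, ← ENNReal.tsum_mul_right,
    ← ENNReal.tsum_mul_left]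
  refine ENNReal.tsum_le_tsum fun C => ?_
  rw [← ENNReal.tsum_mul_left, ← ENNReal.tsum_mul_left]
  refine ENNReal.tsum_le_tsum fun D => ?_
  rcases hB.subset_or_disjoint C.2 with hC | hC
  · rcases hE.subset_or_disjoint D.2 with hD | hD
    · rw [Set.inter_eq_right.2 hC, Set.inter_eq_right.2 hD]
      exact h C C.2 D D.2
    · simp [hD]
  · simp [hC]

/-! ### The quasi-Bernoulli property -/

/-- `μ` is an invariant probability measure giving positive mass to every cylinder, for which
the measure of the concatenation of two words is, up to the factor `K`, the product of the measures
of the two words. -/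
structure QuasiBernoulli (μ : Measure (ShiftSpace A)) (K : ℝ≥0∞) : Prop where
  isProbabilityMeasure : IsProbabilityMeasure μ
  invariant : MeasurePreserving (shift A) μ μ
  ne_top : K ≠ ∞
  one_le : 1 ≤ K
  measure_cylinder_ne_zero : ∀ n x, μ (cylinder n x) ≠ 0
  le_mul : ∀ m n x,
    μ (cylinder (m + n) x) ≤ K * (μ (cylinder m x) * μ (cylinder n ((shift A)^[m] x)))
  mul_le : ∀ m n x,
    μ (cylinder m x) * μ (cylinder n ((shift A)^[m] x)) ≤ K * μ (cylinder (m + n) x)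

/-- Gibbs measures are quasi-Bernoulli, because Birkhoff sums are additive along the orbit
and the Gibbs inequality holds for every point of a cylinder. -/
theorem IsGibbs.exists_quasiBernoulli {φ : ShiftSpace A → ℝ} {μ : Measure (ShiftSpace A)}
    (hμ : IsGibbs φ μ) : ∃ K, QuasiBernoulli μ K := by
  have := hμ.isProbabilityMeasure
  obtain ⟨c, hc, P, hP⟩ := hμ.gibbs
  set w : ℕ → ShiftSpace A → ℝ := fun m x =>
    Real.exp (-(m * P) + birkhoffSum (shift A) φ m x) with hw
  have hwpos : ∀ m x, 0 < w m x := fun m x => Real.exp_pos _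
  have hwadd : ∀ m n x, w (m + n) x = w m x * w n ((shift A)^[m] x) := by
    intro m n x
    simp only [hw]
    rw [← Real.exp_add, birkhoffSum_add]
    congr 1
    push_cast
    ring
  have hup : ∀ m ≥ 1, ∀ x, μ.real (cylinder m x) ≤ c * w m x := fun m hm x =>
    (div_le_iff₀ (hwpos m x)).1 (hP m hm x).2
  have hlow : ∀ m ≥ 1, ∀ x, w m x ≤ c * μ.real (cylinder m x) := fun m hm x => by
    have := (le_div_iff₀ (hwpos m x)).1 (hP m hm x).1
    rwa [inv_mul_le_iff₀ hc] at this
  have hK : (1 : ℝ) ≤ c ^ 3 + 1 := by have := pow_pos hc 3; linarith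
  have hKE : (1 : ℝ≥0∞) ≤ ENNReal.ofReal (c ^ 3 + 1) := by
    rw [← ENNReal.ofReal_one]; exact ENNReal.ofReal_le_ofReal hK
  have key : ∀ m n x,
      μ.real (cylinder (m + n) x) ≤ (c ^ 3 + 1) *
        (μ.real (cylinder m x) * μ.real (cylinder n ((shift A)^[m] x))) ∧
      μ.real (cylinder m x) * μ.real (cylinder n ((shift A)^[m] x)) ≤
        (c ^ 3 + 1) * μ.real (cylinder (m + n) x) := by
    intro m n x
    rcases Nat.eq_zero_or_pos m with rfl | hm
    · simp only [zero_add, cylinder_zero, Function.iterate_zero, id_eq, probReal_univ, one_mul]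
      exact ⟨le_mul_of_one_le_left measureReal_nonneg hK,
        le_mul_of_one_le_left measureReal_nonneg hK⟩
    rcases Nat.eq_zero_or_pos n with rfl | hn
    · simp only [add_zero, cylinder_zero, probReal_univ, mul_one]
      exact ⟨le_mul_of_one_le_left measureReal_nonneg hK,
        le_mul_of_one_le_left measureReal_nonneg hK⟩
    have h1 := hup m hm x
    have h2 := hup n hn ((shift A)^[m] x)
    have h3 := hlow m hm x
    have h4 := hlow n hn ((shift A)^[m] x)
    have h5 := hup (m + n) (by omega) x
    have h6 := hlow (m + n) (by omega) x
    rw [hwadd] at h5 h6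
    have p1 := hwpos m x
    have p2 := hwpos n ((shift A)^[m] x)
    have q0 : 0 ≤ μ.real (cylinder (m + n) x) := measureReal_nonneg
    have q1 : 0 ≤ μ.real (cylinder m x) := measureReal_nonneg
    have q2 : 0 ≤ μ.real (cylinder n ((shift A)^[m] x)) := measureReal_nonneg
    have e1 := mul_le_mul h3 h4 p2.le (by positivity)
    have e2 := mul_le_mul h1 h2 q2 (by positivity)
    constructor
    · calc _ ≤ _ := h5
        _ ≤ c * (c * μ.real (cylinder m x) * (c * μ.real (cylinder n ((shift A)^[m] x)))) := by
          gcongr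
        _ = c ^ 3 * (μ.real (cylinder m x) * μ.real (cylinder n ((shift A)^[m] x))) := by ring
        _ ≤ _ := by gcongr; linarith
    · calc _ ≤ _ := e2
        _ = c * c * (w m x * w n ((shift A)^[m] x)) := by ring
        _ ≤ c * c * (c * μ.real (cylinder (m + n) x)) := by gcongr
        _ = c ^ 3 * μ.real (cylinder (m + n) x) := by ring
        _ ≤ _ := by gcongr; linarith
  refine ⟨ENNReal.ofReal (c ^ 3 + 1), this, hμ.invariant, ENNReal.ofReal_ne_top, hKE, ?_, ?_, ?_⟩
  · intro n x h0
    rcases Nat.eq_zero_or_pos n with rfl | hn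
    · simp [cylinder_zero] at h0
    · have h1 := hlow n hn x
      rw [measureReal_def, h0] at h1
      have := hwpos n x
      simp at h1
      linarith
  · intro m n x
    rw [← ofReal_measureReal, ← ofReal_measureReal, ← ofReal_measureReal,
      ← ENNReal.ofReal_mul measureReal_nonneg, ← ENNReal.ofReal_mul (by positivity)]
    exact ENNReal.ofReal_le_ofReal (key m n x).1
  · intro m n x
    rw [← ofReal_measureReal, ← ofReal_measureReal, ← ofReal_measureReal,
      ← ENNReal.ofReal_mul measureReal_nonneg, ← ENNReal.ofReal_mul (by positivity)]
    exact ENNReal.ofReal_le_ofReal (key m n x).2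

theorem measure_preimage_iterate {μ : Measure (ShiftSpace A)}
    (h : MeasurePreserving (shift A) μ μ) (m : ℕ) {E : Set (ShiftSpace A)}
    (hE : MeasurableSet E) : μ ((shift A)^[m] ⁻¹' E) = μ E :=
  (h.iterate m).measure_preimage hE.nullMeasurableSet

namespace QuasiBernoulli

variable {μ : Measure (ShiftSpace A)} {K : ℝ≥0∞}

theorem measure_ne_zero (h : QuasiBernoulli μ K) {n : ℕ} {C : Set (ShiftSpace A)}
    (hC : C ∈ cylinders A n) : μ C ≠ 0 := by
  obtain ⟨x, rfl⟩ := hC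
  exact h.measure_cylinder_ne_zero n x

variable [Countable I]

/-- The past and a later future are independent up to the factor `K`, as an upper bound. -/
theorem measure_inter_le (h : QuasiBernoulli μ K) {m n p : ℕ} (hmp : m ≤ p)
    {B E : Set (ShiftSpace A)} (hB : DeterminedBy m B) (hE : DeterminedBy n E) :
    μ (B ∩ (shift A)^[p] ⁻¹' E) ≤ K * (μ B * μ E) := by
  refine measure_inter_preimage_le (m := p) (n := n) (fun C hC D hD => ?_) (hB.mono hmp) hE
  by_cases hne : (C ∩ (shift A)^[p] ⁻¹' D).Nonempty
  · obtain ⟨x, hx, hx'⟩ := hne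
    rw [eq_cylinder_of_mem hC hx, eq_cylinder_of_mem hD hx', ← cylinder_add]
    exact h.le_mul p n x
  · rw [Set.not_nonempty_iff_eq_empty.1 hne]
    simp

/-- Up to arbitrarily small measure, the zeroth symbol belongs to a finite set. -/
theorem exists_finset_letters (h : QuasiBernoulli μ K) {η : ℝ≥0∞} (hη : η ≠ 0) :
    ∃ F : Finset I, μ {x | x.1 0 ∉ F} < η := by
  have := h.isProbabilityMeasure
  classical
  have hmeas : ∀ F : Finset I, MeasurableSet {x : ShiftSpace A | x.1 0 ∉ F} := fun F => by
    refine DeterminedBy.measurableSet (n := 1) fun x y hxy hx => ?_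
    simpa [hxy 0 one_pos] using hx
  have hanti : Antitone fun F : Finset I => {x : ShiftSpace A | x.1 0 ∉ F} :=
    fun F G hFG x hx hxF => hx (hFG hxF)
  have ht := tendsto_measure_iInter_atTop (μ := μ) (fun F => (hmeas F).nullMeasurableSet) hanti
    ⟨∅, measure_ne_top _ _⟩
  have he : ⋂ F : Finset I, {x : ShiftSpace A | x.1 0 ∉ F} = ∅ := by
    rw [Set.eq_empty_iff_forall_notMem]
    intro x hx
    exact Set.mem_iInter.1 hx {x.1 0} (Finset.mem_singleton_self _)
  rw [he, measure_empty] at ht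
  exact (ht.eventually (gt_mem_nhds (pos_iff_ne_zero.2 hη))).exists

/-- Big images and preimages: there is a finite set of letters such that every word can be followed
by, and preceded by, one of them. -/
theorem exists_finset_big_images (h : QuasiBernoulli μ K) :
    ∃ F : Finset I, (∀ m, ∀ C ∈ cylinders A m, ∃ x ∈ C, x.1 m ∈ F) ∧
      ∀ n, ∀ D ∈ cylinders A n, ∃ x, shift A x ∈ D ∧ x.1 0 ∈ F := by
  have := h.isProbabilityMeasure
  obtain ⟨F, hF⟩ := h.exists_finset_letters (η := K⁻¹) (ENNReal.inv_ne_zero.2 h.ne_top)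
  have hK0 : K ≠ 0 := (zero_lt_one.trans_le h.one_le).ne'
  have hdet : DeterminedBy 1 {x : ShiftSpace A | x.1 0 ∉ F} := fun x y hxy hx => by
    simpa [hxy 0 one_pos] using hx
  have hlt : ∀ a : ℝ≥0∞, a ≠ 0 → a ≠ ∞ → K * (μ {x : ShiftSpace A | x.1 0 ∉ F} * a) < a := by
    intro a ha ha'
    calc K * (μ {x : ShiftSpace A | x.1 0 ∉ F} * a)
        = (K * a) * μ {x : ShiftSpace A | x.1 0 ∉ F} := by ring
      _ < (K * a) * K⁻¹ := ENNReal.mul_lt_mul_right (mul_ne_zero hK0 ha)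
          (ENNReal.mul_ne_top h.ne_top ha') hF
      _ = a := by rw [mul_right_comm, ENNReal.mul_inv_cancel hK0 h.ne_top, one_mul]
  refine ⟨F, fun m C hC => ?_, fun n D hD => ?_⟩
  -- otherwise the word would only be continued outside `F`, which costs a factor less than one
  · by_contra! hcon
    have hsub : C ⊆ C ∩ (shift A)^[m] ⁻¹' {x : ShiftSpace A | x.1 0 ∉ F} := fun x hx =>
      ⟨hx, by simpa [shift_iterate_apply] using hcon x hx⟩
    have h1 := h.measure_inter_le le_rfl (DeterminedBy.of_mem_cylinders hC) hdet
    have h2 := (measure_mono hsub).trans h1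
    rw [mul_comm (μ C)] at h2
    exact absurd h2 (not_le.2 (hlt _ (h.measure_ne_zero hC) (measure_ne_top _ _)))
  · by_contra! hcon
    have hsub : (shift A)^[1] ⁻¹' D ⊆ {x : ShiftSpace A | x.1 0 ∉ F} ∩ (shift A)^[1] ⁻¹' D :=
      fun x hx => ⟨hcon x hx, hx⟩
    have h1 := h.measure_inter_le le_rfl hdet (DeterminedBy.of_mem_cylinders hD)
    have h2 := (measure_mono hsub).trans h1
    rw [measure_preimage_iterate h.invariant 1 (measurableSet_of_mem_cylinders hD)] at h2
    exact absurd h2 (not_le.2 (hlt _ (h.measure_ne_zero hD) (measure_ne_top _ _)))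

end QuasiBernoulli

/-- Concatenation of the first `m` symbols of `x` with `y`, when the transition is allowed. -/
theorem exists_concat (x y : ShiftSpace A) (m : ℕ)
    (hxy : 0 < m → A (x.1 (m - 1)) (y.1 0) = 1) :
    ∃ w : ShiftSpace A, w ∈ cylinder m x ∧ (shift A)^[m] w = y := by
  have hadm : ∀ i, A (if i < m then x.1 i else y.1 (i - m))
      (if i + 1 < m then x.1 (i + 1) else y.1 (i + 1 - m)) = 1 := by
    intro i
    rcases lt_trichotomy (i + 1) m with hi | hi | hi
    · simpa [show i < m by omega, hi] using x.2 i
    · subst hi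
      simpa using hxy (by omega)
    · have h1 : ¬ i < m := by omega
      have h2 : ¬ i + 1 < m := by omega
      simp only [h1, h2, if_false]
      rw [show i + 1 - m = i - m + 1 by omega]
      exact y.2 _
  let w : ShiftSpace A := ⟨fun i => if i < m then x.1 i else y.1 (i - m), hadm⟩
  refine ⟨w, fun i hi => if_pos hi, Subtype.ext (funext fun i => ?_)⟩
  rw [shift_iterate_apply]
  change (if m + i < m then x.1 (m + i) else y.1 (m + i - m)) = y.1 i
  simp

namespace QuasiBernoulli

variable [Countable I] {μ : Measure (ShiftSpace A)} {K : ℝ≥0∞}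

/-- Under topological mixing, the past and a future beyond a fixed gap `g` are independent up to a
constant factor, as a lower bound. -/
theorem exists_gap (h : QuasiBernoulli μ K) (hA : TopologicallyMixing A) :
    ∃ g : ℕ, ∃ L : ℝ≥0∞, L ≠ ∞ ∧ 1 ≤ L ∧ ∀ m n p : ℕ, m + g ≤ p → ∀ B E : Set (ShiftSpace A),
      DeterminedBy m B → DeterminedBy n E → μ B * μ E ≤ L * μ (B ∩ (shift A)^[p] ⁻¹' E) := by
  have := h.isProbabilityMeasure
  obtain ⟨F, hF1, hF2⟩ := h.exists_finset_big_images
  choose n₀ hn₀ using hA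
  -- one length `N + 1` of connecting words that works for all pairs of letters of `F`
  set N := (∑ a ∈ F, ∑ b ∈ F, n₀ a b) + 1 with hN
  have := nonempty_of_isProbabilityMeasure μ
  have hcon : ∀ a b, a ∈ F → b ∈ F → ∃ z : ShiftSpace A, z.1 0 = a ∧ z.1 N = b := by
    intro a b ha hb
    have h1 : n₀ a b ≤ ∑ b ∈ F, n₀ a b :=
      Finset.single_le_sum (f := fun b => n₀ a b) (fun _ _ => Nat.zero_le _) hb
    have h2 : ∑ b ∈ F, n₀ a b ≤ ∑ a ∈ F, ∑ b ∈ F, n₀ a b :=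
      Finset.single_le_sum (f := fun a => ∑ b ∈ F, n₀ a b) (fun _ _ => Nat.zero_le _) ha
    obtain ⟨z, hz, hz'⟩ := hn₀ a b N (by omega)
    refine ⟨z, hz, ?_⟩
    simpa [letterCylinder, shift_iterate_apply] using hz'
  choose! z hz0 hzN using hcon
  obtain ⟨δ, hδ0, hδ⟩ : ∃ δ : ℝ≥0∞, δ ≠ 0 ∧ ∀ a ∈ F, ∀ b ∈ F,
      δ ≤ μ (cylinder (N + 1) (z a b)) := by
    classical
    refine ⟨(F ×ˢ F).inf fun q => μ (cylinder (N + 1) (z q.1 q.2)), ?_, fun a ha b hb => ?_⟩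
    · rw [← pos_iff_ne_zero, Finset.lt_inf_iff (by simp)]
      exact fun q _ => pos_iff_ne_zero.2 (h.measure_cylinder_ne_zero _ _)
    · exact Finset.inf_le (f := fun q : I × I => μ (cylinder (N + 1) (z q.1 q.2)))
        (Finset.mk_mem_product ha hb)
  have hcyl : ∀ m n, ∀ C ∈ cylinders A m, ∀ D ∈ cylinders A n,
      μ C * μ D ≤ (K * K * δ⁻¹) * μ (C ∩ (shift A)^[m + (N + 1)] ⁻¹' D) := by
    intro m n C hC D hD
    obtain ⟨x, hxC, hxF⟩ := hF1 m C hC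
    obtain ⟨y, hyD, hyF⟩ := hF2 n D hD
    set v := z (x.1 m) (y.1 0) with hv
    have hv0 : v.1 0 = x.1 m := hz0 _ _ hxF hyF
    have hvN : v.1 N = y.1 0 := hzN _ _ hxF hyF
    obtain ⟨u, hu, hu'⟩ := exists_concat v (shift A y) (N + 1) (fun _ => by
      simp only [Nat.add_sub_cancel, hvN]
      exact y.2 0)
    obtain ⟨w, hw, hw'⟩ := exists_concat x u m (fun hm => by
      rw [hu 0 (by omega), hv0]
      have := x.2 (m - 1)
      rwa [Nat.sub_add_cancel hm] at this)
    have hwC : w ∈ C := (DeterminedBy.of_mem_cylinders hC) x w hw hxC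
    have hwD : (shift A)^[m + (N + 1)] w ∈ D := by
      rw [add_comm, Function.iterate_add_apply, hw', hu']
      exact hyD
    have e1 : C = cylinder m w := eq_cylinder_of_mem hC hwC
    have e2 : D = cylinder n ((shift A)^[m + (N + 1)] w) := eq_cylinder_of_mem hD hwD
    have e3 : cylinder (m + (N + 1) + n) w ⊆ C ∩ (shift A)^[m + (N + 1)] ⁻¹' D := by
      rw [cylinder_add, cylinder_add, ← e1, ← e2]
      exact Set.inter_subset_inter_left _ Set.inter_subset_left
    have e4 : cylinder (N + 1) ((shift A)^[m] w) = cylinder (N + 1) v := by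
      rw [hw']
      exact cylinder_eq_of_mem hu
    have hδv : δ ≤ μ (cylinder (N + 1) v) := hδ _ hxF _ hyF
    have hδt : δ ≠ ∞ := ne_top_of_le_ne_top (measure_ne_top _ _) hδv
    calc μ C * μ D = δ⁻¹ * (μ C * δ * μ D) := by
          rw [show δ⁻¹ * (μ C * δ * μ D) = (δ⁻¹ * δ) * (μ C * μ D) by ring,
            ENNReal.inv_mul_cancel hδ0 hδt, one_mul]
      _ ≤ δ⁻¹ * (μ C * μ (cylinder (N + 1) v) * μ D) := by gcongr
      _ ≤ δ⁻¹ * (K * μ (cylinder (m + (N + 1)) w) * μ D) := by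
          refine mul_le_mul' le_rfl (mul_le_mul' ?_ le_rfl)
          have := h.mul_le m (N + 1) w
          rwa [← e1, e4] at this
      _ ≤ δ⁻¹ * (K * (K * μ (cylinder (m + (N + 1) + n) w))) := by
          rw [mul_assoc K]
          refine mul_le_mul' le_rfl (mul_le_mul' le_rfl ?_)
          have := h.mul_le (m + (N + 1)) n w
          rwa [← e2] at this
      _ ≤ δ⁻¹ * (K * (K * μ (C ∩ (shift A)^[m + (N + 1)] ⁻¹' D))) := by gcongr
      _ = _ := by ring
  refine ⟨N + 1, max (K * K * δ⁻¹) 1, ?_, le_max_right _ _, fun m n p hp B E hB hE => ?_⟩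
  · exact (max_lt (ENNReal.mul_lt_top (ENNReal.mul_lt_top h.ne_top.lt_top h.ne_top.lt_top)
      (ENNReal.inv_lt_top.2 (pos_iff_ne_zero.2 hδ0))) ENNReal.one_lt_top).ne
  -- a larger gap reduces to the gap `N + 1` by invariance
  obtain ⟨q, rfl⟩ := Nat.exists_eq_add_of_le hp
  have h1 := measure_mul_le_inter_preimage (hcyl m (q + n)) hB (hE.preimage q)
  rw [measure_preimage_iterate h.invariant q hE.measurableSet, ← Set.preimage_comp,
    ← Function.iterate_add, add_comm q] at h1
  exact h1.trans (by gcongr; exact le_max_left _ _)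

end QuasiBernoulli

/-! ### The Rényi entropy -/

/-- The collision sum `∑ μ(C)²` over the `n`-cylinders, with values in `[0, ∞]`. -/
noncomputable def collision (μ : Measure (ShiftSpace A)) (n : ℕ) : ℝ≥0∞ :=
  ∑' C : cylinders A n, μ (C : Set (ShiftSpace A)) ^ 2

theorem collisionSum_eq_toReal (μ : Measure (ShiftSpace A)) [IsFiniteMeasure μ] (n : ℕ) :
    collisionSum μ n = (collision μ n).toReal := by
  rw [collision, ENNReal.tsum_toReal_eq fun C => ENNReal.pow_ne_top (measure_ne_top μ _)]
  simp [collisionSum, measureReal_def, ENNReal.toReal_pow]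

theorem sq_le_collision (μ : Measure (ShiftSpace A)) {n : ℕ} {C : Set (ShiftSpace A)}
    (hC : C ∈ cylinders A n) : μ C ^ 2 ≤ collision μ n :=
  ENNReal.le_tsum (f := fun C : cylinders A n => μ (C : Set (ShiftSpace A)) ^ 2) ⟨C, hC⟩

theorem QuasiBernoulli.collision_add_le {μ : Measure (ShiftSpace A)} {K : ℝ≥0∞}
    (h : QuasiBernoulli μ K) (m n : ℕ) :
    collision μ (m + n) ≤ K ^ 2 * (collision μ m * collision μ n) := by
  have hrep : ∀ C : cylinders A (m + n), ∃ x, cylinder (m + n) x = (C : Set (ShiftSpace A)) :=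
    fun C => C.2
  choose r hr using hrep
  let ι : cylinders A (m + n) → cylinders A m × cylinders A n := fun C =>
    (⟨cylinder m (r C), cylinder_mem _ _⟩, ⟨cylinder n ((shift A)^[m] (r C)), cylinder_mem _ _⟩)
  have hι : Function.Injective ι := by
    intro C D hCD
    have h1 : cylinder m (r C) = cylinder m (r D) := congrArg (fun q => q.1.1) hCD
    have h2 : cylinder n ((shift A)^[m] (r C)) = cylinder n ((shift A)^[m] (r D)) :=
      congrArg (fun q => q.2.1) hCD
    refine Subtype.ext ?_
    rw [← hr C, ← hr D, cylinder_add, cylinder_add, h1, h2]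
  calc collision μ (m + n)
      ≤ ∑' C, (fun q : cylinders A m × cylinders A n =>
          K ^ 2 * (μ (q.1 : Set (ShiftSpace A)) ^ 2 * μ (q.2 : Set (ShiftSpace A)) ^ 2)) (ι C) := by
        refine ENNReal.tsum_le_tsum fun C => ?_
        simp only [ι]
        rw [← hr C, ← mul_pow, ← mul_pow]
        refine pow_le_pow_left' ?_ 2
        exact h.le_mul m n (r C)
    _ ≤ ∑' q : cylinders A m × cylinders A n,
          K ^ 2 * (μ (q.1 : Set (ShiftSpace A)) ^ 2 * μ (q.2 : Set (ShiftSpace A)) ^ 2) :=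
        ENNReal.tsum_comp_le_tsum_of_injective hι _
    _ = K ^ 2 * (collision μ m * collision μ n) := by
        rw [ENNReal.tsum_mul_left, ENNReal.tsum_prod', collision, collision,
          ← ENNReal.tsum_mul_right]
        simp_rw [ENNReal.tsum_mul_left]

theorem QuasiBernoulli.collision_ne_zero {μ : Measure (ShiftSpace A)} {K : ℝ≥0∞}
    (h : QuasiBernoulli μ K) (n : ℕ) : collision μ n ≠ 0 := by
  have := h.isProbabilityMeasure
  obtain ⟨x⟩ := nonempty_of_isProbabilityMeasure μ
  intro h0
  have := sq_le_collision μ (cylinder_mem n x)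
  rw [h0, nonpos_iff_eq_zero] at this
  exact h.measure_cylinder_ne_zero n x (pow_eq_zero_iff (by norm_num) |>.1 this)

section

variable [Countable I] {μ : Measure (ShiftSpace A)} {K : ℝ≥0∞}

theorem tsum_measure_cylinders [IsProbabilityMeasure μ] (n : ℕ) :
    ∑' C : cylinders A n, μ (C : Set (ShiftSpace A)) = 1 := by
  have := measure_eq_tsum_cylinders μ n Set.univ MeasurableSet.univ
  simpa using this.symm

theorem collision_le_of_forall_le [IsProbabilityMeasure μ] {n : ℕ} {b : ℝ≥0∞}
    (hb : ∀ C ∈ cylinders A n, μ C ≤ b) : collision μ n ≤ b :=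
  calc collision μ n ≤ ∑' C : cylinders A n, b * μ (C : Set (ShiftSpace A)) :=
        ENNReal.tsum_le_tsum fun C => by
          rw [sq]
          exact mul_le_mul' (hb C C.2) le_rfl
    _ = b := by rw [ENNReal.tsum_mul_left, tsum_measure_cylinders, mul_one]

theorem collision_le_one [IsProbabilityMeasure μ] (n : ℕ) : collision μ n ≤ 1 :=
  collision_le_of_forall_le fun _ _ => prob_le_one

theorem collision_ne_top [IsProbabilityMeasure μ] (n : ℕ) : collision μ n ≠ ∞ :=
  ne_top_of_le_ne_top ENNReal.one_ne_top (collision_le_one n)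

end

namespace QuasiBernoulli

variable [Countable I] {μ : Measure (ShiftSpace A)} {K : ℝ≥0∞}

/-- The collision sums decay at most exponentially: a word can always be prolonged by a letter from
a fixed finite set. -/
theorem exists_pow_le_collision (h : QuasiBernoulli μ K) :
    ∃ θ : ℝ≥0∞, θ ≠ 0 ∧ ∀ n, θ ^ n ≤ collision μ n := by
  have := h.isProbabilityMeasure
  obtain ⟨F, hF, -⟩ := h.exists_finset_big_images
  obtain ⟨η, hη0, hη⟩ : ∃ η : ℝ≥0∞, η ≠ 0 ∧ ∀ x : ShiftSpace A, x.1 0 ∈ F →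
      η ≤ μ (cylinder 1 x) := by
    classical
    -- letters of `F` with empty cylinder are given weight one, to keep the infimum positive
    let f : I → ℝ≥0∞ := fun a => if μ (letterCylinder A a) = 0 then 1 else μ (letterCylinder A a)
    refine ⟨F.inf f, ?_, fun x hx => ?_⟩
    · rw [← pos_iff_ne_zero, Finset.lt_inf_iff (by simp)]
      intro a _
      by_cases ha : μ (letterCylinder A a) = 0 <;> simp [f, ha, pos_iff_ne_zero]
    · refine (Finset.inf_le hx).trans ?_
      have := h.measure_cylinder_ne_zero 1 x
      rw [cylinder_one] at this ⊢
      simp [f, this]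
  have hθ : ∀ n, ∃ x : ShiftSpace A, (K⁻¹ * η) ^ n ≤ μ (cylinder n x) := by
    intro n
    induction n with
    | zero =>
      obtain ⟨x⟩ := nonempty_of_isProbabilityMeasure μ
      exact ⟨x, by simp [cylinder_zero]⟩
    | succ n ih =>
      obtain ⟨x, hx⟩ := ih
      obtain ⟨y, hy, hyF⟩ := hF n _ (cylinder_mem n x)
      refine ⟨y, ?_⟩
      rw [← cylinder_eq_of_mem hy] at hx
      have h1 := h.mul_le n 1 y
      have h2 : η ≤ μ (cylinder 1 ((shift A)^[n] y)) := hη _ (by rwa [shift_iterate_apply])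
      have hK0 : K ≠ 0 := (zero_lt_one.trans_le h.one_le).ne'
      calc (K⁻¹ * η) ^ (n + 1) = K⁻¹ * ((K⁻¹ * η) ^ n * η) := by ring
        _ ≤ K⁻¹ * (K * μ (cylinder (n + 1) y)) := by
          refine mul_le_mul' le_rfl ?_
          exact (mul_le_mul' hx h2).trans h1
        _ = μ (cylinder (n + 1) y) := by
          rw [← mul_assoc, ENNReal.inv_mul_cancel hK0 h.ne_top, one_mul]
  refine ⟨(K⁻¹ * η) ^ 2, by simp [hη0, h.ne_top], fun n => ?_⟩
  obtain ⟨x, hx⟩ := hθ n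
  rw [pow_right_comm]
  exact (pow_le_pow_left' hx 2).trans (sq_le_collision μ (cylinder_mem n x))

/-- The collision sums become arbitrarily small, since the measure of cylinders tends to zero
uniformly: beyond the gap, two different letters
both occur with a definite conditional probability, so a definite proportion of the
measure of a cylinder is lost. -/
theorem exists_collision_lt [Nontrivial I] (h : QuasiBernoulli μ K)
    (hA : TopologicallyMixing A) (ε : ℝ≥0∞) (hε : ε ≠ 0) : ∃ n ≠ 0, collision μ n < ε := by
  have := h.isProbabilityMeasure
  obtain ⟨g, L, hL, hL1, hgap⟩ := h.exists_gap hA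
  obtain ⟨a, b, hab⟩ := exists_pair_ne I
  have hpos : ∀ a : I, μ (letterCylinder A a) ≠ 0 := by
    intro a
    obtain ⟨n₀, hn₀⟩ := hA a a
    obtain ⟨x, hx, -⟩ := hn₀ (n₀ + 1) (by omega)
    have := h.measure_cylinder_ne_zero 1 x
    rwa [cylinder_one, show x.1 0 = a from hx] at this
  set η := min (μ (letterCylinder A a)) (μ (letterCylinder A b)) with hη
  have hη0 : η ≠ 0 := by
    rcases min_choice (μ (letterCylinder A a)) (μ (letterCylinder A b)) with h' | h' <;>
      rw [hη, h'] <;> exact hpos _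
  set r : ℝ≥0∞ := 1 - L⁻¹ * η with hr
  have hr1 : r < 1 := ENNReal.sub_lt_self ENNReal.one_ne_top one_ne_zero
    (mul_ne_zero (ENNReal.inv_ne_zero.2 hL) hη0)
  have hL0 : L ≠ 0 := (zero_lt_one.trans_le hL1).ne'
  have hletter : ∀ c, η ≤ μ (letterCylinder A c) → ∀ m, ∀ x : ShiftSpace A, x.1 (m + g) ≠ c →
      μ (cylinder (m + (g + 1)) x) ≤ μ (cylinder m x) * r := by
    intro c hc m x hx
    set S := cylinder m x ∩ (shift A)^[m + g] ⁻¹' letterCylinder A c with hS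
    have hSm : MeasurableSet S := (measurableSet_of_mem_cylinders (cylinder_mem m x)).inter
      ((determinedBy_letter c).preimage _).measurableSet
    have h1 : μ (cylinder m x) * (L⁻¹ * η) ≤ μ S := by
      have := hgap m 1 (m + g) le_rfl _ _ (DeterminedBy.of_mem_cylinders (cylinder_mem m x))
        (determinedBy_letter c)
      calc μ (cylinder m x) * (L⁻¹ * η) = L⁻¹ * (μ (cylinder m x) * η) := by ring
        _ ≤ L⁻¹ * (L * μ S) := by
          refine mul_le_mul' le_rfl ?_
          exact (mul_le_mul' le_rfl hc).trans this
        _ = μ S := by rw [← mul_assoc, ENNReal.inv_mul_cancel hL0 hL, one_mul]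
    have h2 : cylinder (m + (g + 1)) x ⊆ cylinder m x \ S := by
      intro y hy
      refine ⟨fun i hi => hy i (by omega), fun hyS => hx ?_⟩
      have h3 : ((shift A)^[m + g] y).1 0 = c := hyS.2
      rw [shift_iterate_apply, add_zero, hy _ (by omega)] at h3
      exact h3
    calc μ (cylinder (m + (g + 1)) x) ≤ μ (cylinder m x \ S) := measure_mono h2
      _ = μ (cylinder m x) - μ S :=
        measure_sdiff Set.inter_subset_left hSm.nullMeasurableSet (measure_ne_top _ _)
      _ ≤ μ (cylinder m x) - μ (cylinder m x) * (L⁻¹ * η) := tsub_le_tsub_left h1 _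
      _ = μ (cylinder m x) * r := by
        rw [hr, ENNReal.mul_sub fun _ _ => measure_ne_top _ _, mul_one]
  have hpow : ∀ q, ∀ x : ShiftSpace A, μ (cylinder (q * (g + 1)) x) ≤ r ^ q := by
    intro q
    induction q with
    | zero => intro x; simp [cylinder_zero]
    | succ q ih =>
      intro x
      rw [add_mul, one_mul, pow_succ]
      refine le_trans ?_ (mul_le_mul' (ih x) le_rfl)
      by_cases hxa : x.1 (q * (g + 1) + g) = a
      · exact hletter b (min_le_right _ _) _ x (hxa ▸ hab)
      · exact hletter a (min_le_left _ _) _ x hxa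
  have ht := ENNReal.tendsto_pow_atTop_nhds_zero_of_lt_one hr1
  obtain ⟨q, hq, hq1⟩ := ((ht.eventually (gt_mem_nhds (pos_iff_ne_zero.2 hε))).and
    (eventually_ge_atTop 1)).exists
  refine ⟨q * (g + 1), by positivity, lt_of_le_of_lt ?_ hq⟩
  refine collision_le_of_forall_le fun C hC => ?_
  obtain ⟨x, rfl⟩ := hC
  exact hpow q x

/-- The Rényi entropy exists and is positive, by Fekete's lemma. -/
theorem exists_renyiEntropy [Nontrivial I] (h : QuasiBernoulli μ K)
    (hA : TopologicallyMixing A) : ∃ H, 0 < H ∧ HasRenyiEntropy μ H := by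
  have := h.isProbabilityMeasure
  have hK0 : K ≠ 0 := (zero_lt_one.trans_le h.one_le).ne'
  have hKr : 0 < K.toReal := ENNReal.toReal_pos hK0 h.ne_top
  have hZ : ∀ n, 0 < (collision μ n).toReal := fun n =>
    ENNReal.toReal_pos (h.collision_ne_zero n) (collision_ne_top n)
  set u : ℕ → ℝ := fun n => Real.log (K.toReal ^ 2 * (collision μ n).toReal) with hu
  have hsub : Subadditive u := by
    intro m n
    have h1 := ENNReal.toReal_mono (ENNReal.mul_ne_top (ENNReal.pow_ne_top h.ne_top)
      (ENNReal.mul_ne_top (collision_ne_top m) (collision_ne_top n))) (h.collision_add_le m n)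
    simp only [ENNReal.toReal_mul, ENNReal.toReal_pow] at h1
    have p1 := hZ m
    have p2 := hZ n
    have p3 := hZ (m + n)
    simp only [hu]
    rw [← Real.log_mul (by positivity) (by positivity)]
    refine Real.log_le_log (by positivity) ?_
    calc _ ≤ K.toReal ^ 2 * (K.toReal ^ 2 * ((collision μ m).toReal * (collision μ n).toReal)) := by
          gcongr
      _ = _ := by ring
  obtain ⟨θ, hθ0, hθ⟩ := h.exists_pow_le_collision
  have hθ1 : θ ≤ 1 := by simpa using (hθ 1).trans (collision_le_one 1)
  have hθr : 0 < θ.toReal := ENNReal.toReal_pos hθ0 (ne_top_of_le_ne_top ENNReal.one_ne_top hθ1)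
  have hK1 : 1 ≤ K.toReal := by
    simpa using ENNReal.toReal_mono h.ne_top h.one_le
  have hbdd : BddBelow (Set.range fun n => u n / n) := by
    refine ⟨min 0 (Real.log θ.toReal), ?_⟩
    rintro _ ⟨n, rfl⟩
    rcases Nat.eq_zero_or_pos n with rfl | hn
    · simp
    refine (min_le_right _ _).trans ?_
    have hn' : (0 : ℝ) < n := by exact_mod_cast hn
    change _ ≤ u n / n
    rw [le_div_iff₀ hn', mul_comm, ← Real.log_pow]
    refine Real.log_le_log (by positivity) ?_
    have h1 := ENNReal.toReal_mono (collision_ne_top n) (hθ n)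
    rw [ENNReal.toReal_pow] at h1
    exact h1.trans (le_mul_of_one_le_left (hZ n).le (one_le_pow₀ hK1))
  have hlim := hsub.tendsto_lim hbdd
  have hneg : hsub.lim < 0 := by
    obtain ⟨n, hn0, hn⟩ := h.exists_collision_lt hA (K ^ 2)⁻¹
      (ENNReal.inv_ne_zero.2 (ENNReal.pow_ne_top h.ne_top))
    refine (hsub.lim_le_div hbdd hn0).trans_lt ?_
    have hn' : (0 : ℝ) < n := by exact_mod_cast Nat.pos_of_ne_zero hn0
    refine div_neg_of_neg_of_pos (Real.log_neg (mul_pos (by positivity) (hZ n)) ?_) hn'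
    have h1 := ENNReal.toReal_strict_mono (by simp [hK0]) hn
    rw [ENNReal.toReal_inv, ENNReal.toReal_pow, lt_inv_comm₀ (hZ n) (by positivity)] at h1
    rwa [← lt_div_iff₀ (hZ n), ← inv_eq_one_div]
  refine ⟨-hsub.lim, neg_pos.2 hneg, ?_⟩
  have h2 : Tendsto (fun n : ℕ => Real.log (K.toReal ^ 2) / n) atTop (𝓝 0) :=
    tendsto_const_div_atTop_nhds_zero_nat _
  have h3 := (hlim.sub h2).neg
  rw [sub_zero] at h3
  refine h3.congr fun n => ?_
  rw [collisionSum_eq_toReal, ← sub_div, div_neg]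
  simp only [hu]
  rw [Real.log_mul (by positivity) (hZ n).ne', add_sub_cancel_left]

end QuasiBernoulli

theorem HasRenyiEntropy.eventually_le {μ : Measure (ShiftSpace A)} {H : ℝ}
    (h : HasRenyiEntropy μ H) (hpos : ∀ n, 0 < collisionSum μ n) {a : ℝ} (ha : a < H) :
    ∀ᶠ n : ℕ in atTop, collisionSum μ n ≤ Real.exp (-(a * n)) := by
  filter_upwards [h.eventually (lt_mem_nhds ha), eventually_gt_atTop 0] with n hn hn0
  have hn' : (0 : ℝ) < n := by exact_mod_cast hn0
  rw [div_neg, lt_neg, div_lt_iff₀ hn'] at hn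
  rw [← Real.log_le_iff_le_exp (hpos n)]
  linarith

theorem HasRenyiEntropy.eventually_ge {μ : Measure (ShiftSpace A)} {H : ℝ}
    (h : HasRenyiEntropy μ H) (hpos : ∀ n, 0 < collisionSum μ n) {a : ℝ} (ha : H < a) :
    ∀ᶠ n : ℕ in atTop, Real.exp (-(a * n)) ≤ collisionSum μ n := by
  filter_upwards [h.eventually (gt_mem_nhds ha), eventually_gt_atTop 0] with n hn hn0
  have hn' : (0 : ℝ) < n := by exact_mod_cast hn0
  rw [div_neg, neg_lt, lt_div_iff₀ hn'] at hn
  rw [← Real.le_log_iff_exp_le (hpos n)]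
  linarith

/-! ### Repetitions and the upper bound -/

/-- The points whose words of length `k` at the positions `p` and `q` coincide. -/
def matchSet (A : Matrix I I (Fin 2)) (k p q : ℕ) : Set (ShiftSpace A) :=
  {x | ∀ l < k, x.1 (p + l) = x.1 (q + l)}

theorem mem_matchSet_iff {k p q : ℕ} {x : ShiftSpace A} :
    x ∈ matchSet A k p q ↔ ∃ C ∈ cylinders A k, (shift A)^[p] x ∈ C ∧ (shift A)^[q] x ∈ C := by
  constructor
  · refine fun h => ⟨_, cylinder_mem k ((shift A)^[q] x), fun l hl => ?_, mem_cylinder_self _ _⟩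
    rw [shift_iterate_apply, shift_iterate_apply]
    exact h l hl
  · rintro ⟨_, ⟨y, rfl⟩, h1, h2⟩ l hl
    have := (h1 l hl).trans (h2 l hl).symm
    rwa [shift_iterate_apply, shift_iterate_apply] at this

theorem matchSet_add (k p d : ℕ) :
    matchSet A k p (p + d) = (shift A)^[p] ⁻¹' matchSet A k 0 d := by
  ext x
  simp only [matchSet, Set.mem_preimage, Set.mem_ofPred_eq, shift_iterate_apply, zero_add,
    add_assoc]

theorem determinedBy_matchSet {k p q n : ℕ} (hp : p + k ≤ n) (hq : q + k ≤ n) :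
    DeterminedBy n (matchSet A k p q) := by
  intro x y hxy hx l hl
  rw [hxy _ (by omega), hxy _ (by omega)]
  exact hx l hl

theorem measure_matchSet_eq_tsum [Countable I] (μ : Measure (ShiftSpace A)) (k p q : ℕ) :
    μ (matchSet A k p q) = ∑' C : cylinders A k,
      μ ((shift A)^[p] ⁻¹' (C : Set (ShiftSpace A)) ∩ (shift A)^[q] ⁻¹' C) := by
  rw [← measure_iUnion]
  · congr 1
    ext x
    simp only [mem_matchSet_iff, Set.mem_iUnion, Subtype.exists, exists_prop, Set.mem_inter_iff,
      Set.mem_preimage]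
  · intro C D h
    exact ((cylinders_pairwiseDisjoint k h).preimage _).mono Set.inter_subset_left
      Set.inter_subset_left
  · intro C
    exact (measurable_shift_iterate p (measurableSet_of_mem_cylinders C.2)).inter
      (measurable_shift_iterate q (measurableSet_of_mem_cylinders C.2))

/-- A word of length `k + d` with a small period `d` also has a period of at least `k / 2`, namely a
multiple of `d`, for which the two occurrences of its prefix of length `k / 2` do not overlap. -/
theorem exists_matchSet_subset {d : ℕ} (k : ℕ) (hd : 0 < d) :
    ∃ e, k / 2 ≤ e ∧ matchSet A k 0 d ⊆ matchSet A (k / 2) 0 e := by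
  have hdm := Nat.div_add_mod (k / 2) d
  have hlt := Nat.mod_lt (k / 2) hd
  refine ⟨d * (k / 2 / d + 1), by rw [mul_add]; omega, fun x hx => ?_⟩
  have key : ∀ i l, l + d * i < k + d → x.1 l = x.1 (d * i + l) := by
    intro i
    induction i with
    | zero => intro l _; simp
    | succ i ih =>
      intro l hl
      rw [mul_add, mul_one] at hl ⊢
      rw [ih l (by omega)]
      have := hx (d * i + l) (by omega)
      rw [zero_add] at this
      rw [this]
      exact congrArg x.1 (by omega)
  intro l hl
  rw [zero_add]
  refine key _ _ ?_
  rw [mul_add]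
  omega

theorem repeatLengths_mono (x : ShiftSpace A) {m n : ℕ} (hmn : m ≤ n) :
    repeatLengths x m ⊆ repeatLengths x n := by
  rintro k ⟨i, j, hij, hj, h⟩
  exact ⟨i, j, hij, hj.trans_le hmn, h⟩

theorem mem_repeatLengths_of_le {x : ShiftSpace A} {n k l : ℕ} (hkl : k ≤ l)
    (hl : l ∈ repeatLengths x n) : k ∈ repeatLengths x n := by
  obtain ⟨i, j, hij, hj, h⟩ := hl
  exact ⟨i, j, hij, hj, fun s hs => h s (by omega)⟩

/-- The Borel–Cantelli lemma with a real summable majorant. -/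
theorem ae_eventually_notMem_of_summable {α : Type*} [MeasurableSpace α] {μ : Measure α}
    [IsFiniteMeasure μ] {s : ℕ → Set α} {f : ℕ → ℝ} (hf : Summable f)
    (h : ∀ᶠ k in atTop, μ.real (s k) ≤ f k) : ∀ᵐ x ∂μ, ∀ᶠ k in atTop, x ∉ s k := by
  refine ae_eventually_notMem ?_
  have hs : Summable fun k => μ.real (s k) := by
    refine hf.of_norm_bounded_eventually_nat ?_
    filter_upwards [h] with k hk
    rwa [Real.norm_of_nonneg measureReal_nonneg]
  have he : ∀ k, μ (s k) = ENNReal.ofReal (μ.real (s k)) := fun k =>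
    (ofReal_measureReal (measure_ne_top μ _)).symm
  simp_rw [he]
  exact hs.tsum_ofReal_ne_top

theorem QuasiBernoulli.collisionSum_pos {μ : Measure (ShiftSpace A)} {K : ℝ≥0∞} [Countable I]
    (h : QuasiBernoulli μ K) (n : ℕ) : 0 < collisionSum μ n := by
  have := h.isProbabilityMeasure
  rw [collisionSum_eq_toReal]
  exact ENNReal.toReal_pos (h.collision_ne_zero n) (collision_ne_top n)

namespace QuasiBernoulli

variable [Countable I] {μ : Measure (ShiftSpace A)} {K : ℝ≥0∞}

theorem measure_matchSet_le (h : QuasiBernoulli μ K) {k d : ℕ} (hkd : k ≤ d) :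
    μ (matchSet A k 0 d) ≤ K * collision μ k := by
  rw [measure_matchSet_eq_tsum, collision, ← ENNReal.tsum_mul_left]
  refine ENNReal.tsum_le_tsum fun C => ?_
  rw [sq]
  exact h.measure_inter_le hkd (DeterminedBy.of_mem_cylinders C.2)
    (DeterminedBy.of_mem_cylinders C.2)

theorem measure_matchSet_le_half (h : QuasiBernoulli μ K) (k : ℕ) {d : ℕ} (hd : 0 < d) :
    μ (matchSet A k 0 d) ≤ K * collision μ (k / 2) := by
  obtain ⟨e, he, hsub⟩ := exists_matchSet_subset (A := A) k hd
  exact (measure_mono hsub).trans (h.measure_matchSet_le he)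

/-- First moment bound: at most `n²` pairs of positions at distance at least `k`, and at most
`n k` pairs of overlapping positions. -/
theorem measure_repeat_le (h : QuasiBernoulli μ K) (n k : ℕ) :
    μ {x | k ∈ repeatLengths x n} ≤
      n * (n * (K * collision μ k) + k * (K * collision μ (k / 2))) := by
  have hsub : {x : ShiftSpace A | k ∈ repeatLengths x n} ⊆
      ⋃ i ∈ Finset.range n, ⋃ d ∈ Finset.Ico 1 n, matchSet A k i (i + d) := by
    rintro x ⟨i, j, hij, hj, hx⟩
    simp only [Set.mem_iUnion, Finset.mem_range, Finset.mem_Ico, exists_prop]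
    refine ⟨i, by omega, j - i, by omega, ?_⟩
    rw [show i + (j - i) = j by omega]
    exact hx
  have hterm : ∀ i, ∀ d ∈ Finset.Ico 1 n, μ (matchSet A k i (i + d)) ≤
      K * collision μ k + if d < k then K * collision μ (k / 2) else 0 := by
    intro i d hd
    rw [matchSet_add, measure_preimage_iterate h.invariant i
      (determinedBy_matchSet (n := d + k) (by omega) le_rfl).measurableSet]
    split_ifs with hdk
    · exact (h.measure_matchSet_le_half k (Finset.mem_Ico.1 hd).1).trans le_add_self
    · exact (h.measure_matchSet_le (not_lt.1 hdk)).trans le_self_add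
  refine (measure_mono hsub).trans ((measure_biUnion_finset_le _ _).trans ?_)
  calc ∑ i ∈ Finset.range n, μ (⋃ d ∈ Finset.Ico 1 n, matchSet A k i (i + d))
      ≤ ∑ i ∈ Finset.range n, (n * (K * collision μ k) + k * (K * collision μ (k / 2))) := by
        refine Finset.sum_le_sum fun i _ => (measure_biUnion_finset_le _ _).trans ?_
        refine (Finset.sum_le_sum (hterm i)).trans ?_
        rw [Finset.sum_add_distrib, Finset.sum_const, nsmul_eq_mul, ← Finset.sum_filter,
          Finset.sum_const, nsmul_eq_mul]
        gcongr
        · simp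
        · calc _ ≤ (Finset.range k).card := Finset.card_le_card fun d hd => by
                  simp only [Finset.mem_filter, Finset.mem_range] at hd ⊢
                  exact hd.2
            _ = k := Finset.card_range k
    _ = _ := by rw [Finset.sum_const, Finset.card_range, nsmul_eq_mul]

theorem measureReal_repeat_le (h : QuasiBernoulli μ K) (n k : ℕ) :
    μ.real {x | k ∈ repeatLengths x n} ≤
      n * (n * (K.toReal * collisionSum μ k) + k * (K.toReal * collisionSum μ (k / 2))) := by
  have := h.isProbabilityMeasure
  have h1 := h.measure_repeat_le n k
  have t1 : (n : ℝ≥0∞) * (K * collision μ k) ≠ ∞ := ENNReal.mul_ne_top (ENNReal.natCast_ne_top n)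
    (ENNReal.mul_ne_top h.ne_top (collision_ne_top k))
  have t2 : (k : ℝ≥0∞) * (K * collision μ (k / 2)) ≠ ∞ := ENNReal.mul_ne_top
    (ENNReal.natCast_ne_top k) (ENNReal.mul_ne_top h.ne_top (collision_ne_top _))
  have h2 := ENNReal.toReal_mono
    (ENNReal.mul_ne_top (ENNReal.natCast_ne_top n) (ENNReal.add_ne_top.2 ⟨t1, t2⟩)) h1
  rw [ENNReal.toReal_mul, ENNReal.toReal_add t1 t2] at h2
  simpa only [measureReal_def, ENNReal.toReal_mul, ENNReal.toReal_natCast,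
    ← collisionSum_eq_toReal] using h2

/-- Upper bound: almost surely there is eventually no repetition of length `k` among the
first `exp (a k / 2)` positions, for `a < H₂(μ)`. -/
theorem ae_eventually_notMem_repeatLengths (h : QuasiBernoulli μ K) {H : ℝ}
    (hH : HasRenyiEntropy μ H) {a : ℝ} (ha : 0 < a) (haH : a < H) :
    ∀ᵐ x ∂μ, ∀ᶠ k : ℕ in atTop, k ∉ repeatLengths x ⌊Real.exp (a * k / 2)⌋₊ := by
  have := h.isProbabilityMeasure
  obtain ⟨b, hab, hbH⟩ := exists_between haH
  have hZ := hH.eventually_le h.collisionSum_pos hbH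
  have hhalf : Tendsto (fun k : ℕ => k / 2) atTop atTop :=
    Nat.tendsto_div_const_atTop (by norm_num)
  set c := (b - a) / 2 with hc
  have hc0 : 0 < c := by linarith
  have hs0 : Summable fun k : ℕ => Real.exp (-c * k) := by
    simpa using Real.summable_pow_mul_exp_neg_nat_mul 0 hc0
  have hs1 : Summable fun k : ℕ => (k : ℝ) * Real.exp (-c * k) := by
    simpa using Real.summable_pow_mul_exp_neg_nat_mul 1 hc0
  refine ae_eventually_notMem_of_summable
    (s := fun k : ℕ => {x | k ∈ repeatLengths x ⌊Real.exp (a * k / 2)⌋₊})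
    ((hs0.mul_left K.toReal).add (hs1.mul_left (K.toReal * Real.exp (b / 2)))) ?_
  filter_upwards [hZ, hhalf.eventually hZ] with k h1 h2
  refine (h.measureReal_repeat_le _ k).trans ?_
  have hn : (⌊Real.exp (a * k / 2)⌋₊ : ℝ) ≤ Real.exp (a * k / 2) :=
    Nat.floor_le (Real.exp_pos _).le
  have hk2 : (k : ℝ) - 1 ≤ 2 * (k / 2 : ℕ) := by
    have : k ≤ 2 * (k / 2) + 1 := by omega
    have : (k : ℝ) ≤ 2 * (k / 2 : ℕ) + 1 := by exact_mod_cast this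
    linarith
  have hb0 : 0 < b := ha.trans hab
  have e1 : Real.exp (a * k / 2) * (Real.exp (a * k / 2) * Real.exp (-(b * k))) ≤
      Real.exp (-c * k) := by
    rw [← Real.exp_add, ← Real.exp_add]
    refine Real.exp_le_exp.2 ?_
    have : 0 ≤ c * k := by positivity
    rw [hc] at this ⊢
    linarith
  have e2 : Real.exp (a * k / 2) * Real.exp (-(b * (k / 2 : ℕ))) ≤
      Real.exp (b / 2) * Real.exp (-c * k) := by
    rw [← Real.exp_add, ← Real.exp_add]
    refine Real.exp_le_exp.2 ?_
    have := mul_le_mul_of_nonneg_left hk2 hb0.le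
    rw [hc]
    linarith
  have hK : 0 ≤ K.toReal := ENNReal.toReal_nonneg
  calc _ ≤ Real.exp (a * k / 2) * (Real.exp (a * k / 2) * (K.toReal * Real.exp (-(b * k))) +
        k * (K.toReal * Real.exp (-(b * (k / 2 : ℕ))))) := by
        have p1 := (h.collisionSum_pos k).le
        have p2 := (h.collisionSum_pos (k / 2)).le
        gcongr
    _ = K.toReal * (Real.exp (a * k / 2) * (Real.exp (a * k / 2) * Real.exp (-(b * k)))) +
        K.toReal * k * (Real.exp (a * k / 2) * Real.exp (-(b * (k / 2 : ℕ)))) := by ring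
    _ ≤ K.toReal * Real.exp (-c * k) +
        K.toReal * k * (Real.exp (b / 2) * Real.exp (-c * k)) := by gcongr
    _ = _ := by ring

end QuasiBernoulli

/-! ### The second moment method -/

/-- A second moment lower bound for the probability of a finite union, obtained by
integrating `1_{T > 0} ≥ 2 t T - t² T²` for the number `T` of events that occur. -/
theorem second_moment_le_measureReal_iUnion {α ι : Type*} [MeasurableSpace α] [Fintype ι]
    {μ : Measure α} [IsFiniteMeasure μ] {M : ι → Set α} (hM : ∀ s, MeasurableSet (M s)) (t : ℝ) :
    2 * t * ∑ s, μ.real (M s) - t ^ 2 * ∑ s, ∑ s', μ.real (M s ∩ M s') ≤ μ.real (⋃ s, M s) := by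
  classical
  set T : α → ℝ := fun x => ∑ s, (M s).indicator 1 x with hT
  have hT2 : ∀ x, T x ^ 2 = ∑ s, ∑ s', (M s ∩ M s').indicator (1 : α → ℝ) x := by
    intro x
    simp only [hT, sq, Finset.sum_mul_sum]
    refine Finset.sum_congr rfl fun s _ => Finset.sum_congr rfl fun s' _ => ?_
    rw [Set.inter_indicator_one]
    rfl
  have hint : ∀ S : Set α, MeasurableSet S → Integrable (S.indicator (1 : α → ℝ)) μ :=
    fun S hS => (integrable_const (1 : ℝ)).indicator hS
  have i1 : Integrable T μ := integrable_finsetSum _ fun s _ => hint _ (hM s)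
  have i2 : Integrable (fun x => T x ^ 2) μ := by
    simp_rw [hT2]
    exact integrable_finsetSum _ fun s _ => integrable_finsetSum _ fun s' _ =>
      hint _ ((hM s).inter (hM s'))
  have e1 : ∫ x, T x ∂μ = ∑ s, μ.real (M s) := by
    rw [hT, integral_finsetSum _ fun s _ => hint _ (hM s)]
    exact Finset.sum_congr rfl fun s _ => integral_indicator_one (hM s)
  have e2 : ∫ x, T x ^ 2 ∂μ = ∑ s, ∑ s', μ.real (M s ∩ M s') := by
    simp_rw [hT2]
    rw [integral_finsetSum _ fun s _ => integrable_finsetSum _ fun s' _ =>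
      hint _ ((hM s).inter (hM s'))]
    refine Finset.sum_congr rfl fun s _ => ?_
    rw [integral_finsetSum _ fun s' _ => hint _ ((hM s).inter (hM s'))]
    exact Finset.sum_congr rfl fun s' _ => integral_indicator_one ((hM s).inter (hM s'))
  have hU : MeasurableSet (⋃ s, M s) := MeasurableSet.iUnion hM
  rw [← e1, ← e2, ← integral_const_mul, ← integral_const_mul,
    ← integral_sub (i1.const_mul _) (i2.const_mul _), ← integral_indicator_one hU]
  refine integral_mono ((i1.const_mul _).sub (i2.const_mul _)) (hint _ hU) fun x => ?_
  by_cases hx : x ∈ ⋃ s, M s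
  · simp only [Set.indicator_of_mem hx, Pi.one_apply]
    nlinarith [sq_nonneg (1 - t * T x)]
  · have hT0 : T x = 0 := Finset.sum_eq_zero fun s _ =>
      Set.indicator_of_notMem (fun hs => hx (Set.mem_iUnion.2 ⟨s, hs⟩)) _
    simp [Set.indicator_of_notMem hx, hT0]

theorem add_sq_le_four_mul (x y : ℝ≥0∞) : (x + y) ^ 2 ≤ 4 * x ^ 2 + 4 * y ^ 2 := by
  rcases le_total x y with h | h
  · calc (x + y) ^ 2 ≤ (y + y) ^ 2 := by gcongr
      _ = 4 * y ^ 2 := by ring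
      _ ≤ _ := le_add_self
  · calc (x + y) ^ 2 ≤ (x + x) ^ 2 := by gcongr
      _ = 4 * x ^ 2 := by ring
      _ ≤ _ := le_self_add

namespace QuasiBernoulli

variable [Countable I] {μ : Measure (ShiftSpace A)} {K : ℝ≥0∞}

/-- The joint law of two words at positions in a grid of mesh `w ≥ k`; the first term is the
diagonal contribution of a word with itself. -/
theorem measure_two_words_le (h : QuasiBernoulli μ K) {k w : ℕ} (hkw : k ≤ w) (a a' : ℕ)
    (C D : cylinders A k) [Decidable (C = D)] :
    μ ((shift A)^[a * w] ⁻¹' (C : Set (ShiftSpace A)) ∩ (shift A)^[a' * w] ⁻¹' D) ≤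
      (if a = a' then (if C = D then μ (C : Set (ShiftSpace A)) else 0) else 0) +
        K * (μ (C : Set (ShiftSpace A)) * μ (D : Set (ShiftSpace A))) := by
  have hinv : ∀ (m : ℕ) (C : cylinders A k),
      μ ((shift A)^[m] ⁻¹' (C : Set (ShiftSpace A))) = μ (C : Set (ShiftSpace A)) := fun m C =>
    measure_preimage_iterate h.invariant m (measurableSet_of_mem_cylinders C.2)
  have hlt : ∀ (a a' : ℕ) (C D : cylinders A k), a < a' →
      μ ((shift A)^[a * w] ⁻¹' (C : Set (ShiftSpace A)) ∩ (shift A)^[a' * w] ⁻¹' D) ≤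
        K * (μ (C : Set (ShiftSpace A)) * μ (D : Set (ShiftSpace A))) := by
    intro a a' C D haa
    have hle : a * w + k ≤ a' * w := by nlinarith
    have := h.measure_inter_le hle ((DeterminedBy.of_mem_cylinders C.2).preimage (a * w))
      (DeterminedBy.of_mem_cylinders D.2)
    rwa [hinv] at this
  rcases lt_trichotomy a a' with ha | rfl | ha
  · exact (hlt a a' C D ha).trans le_add_self
  · by_cases hCD : C = D
    · subst hCD
      simp [hinv]
    · have hd := (cylinders_pairwiseDisjoint k hCD).preimage ((shift A)^[a * w])
      rw [hd.inter_eq, measure_empty]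
      exact zero_le
  · rw [Set.inter_comm, mul_comm (μ (C : Set (ShiftSpace A)))]
    exact (hlt a' a D C ha).trans le_add_self

/-- Second moment of the number of coincidences between `N` early and `N` late words, when the
expected number of coincidences is at least of order one. -/
theorem sum_measure_matchSet_inter_le (h : QuasiBernoulli μ K) {k w N : ℕ} (hkw : k ≤ w)
    (hN : 1 ≤ (N : ℝ≥0∞) ^ 2 * collision μ k) :
    ∑ s : Fin N × Fin N, ∑ s' : Fin N × Fin N,
        μ (matchSet A k (s.1 * w) ((N + s.2) * w) ∩ matchSet A k (s'.1 * w) ((N + s'.2) * w)) ≤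
      8 * K ^ 3 * ((N : ℝ≥0∞) ^ 2 * collision μ k) ^ 2 := by
  classical
  let V : cylinders A k × cylinders A k → Fin N → Fin N → Set (ShiftSpace A) := fun p a a' =>
    (shift A)^[a * w] ⁻¹' (p.1 : Set (ShiftSpace A)) ∩ (shift A)^[a' * w] ⁻¹' p.2
  have hV : ∀ p a a', DeterminedBy (N * w) (V p a a') := by
    intro p a a'
    have hle : ∀ a : Fin N, a * w + k ≤ N * w := fun a => by
      have := a.2
      nlinarith
    exact ((DeterminedBy.of_mem_cylinders p.1.2).preimage _ |>.mono (hle a)).inter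
      ((DeterminedBy.of_mem_cylinders p.2.2).preimage _ |>.mono (hle a'))
  have hpair : ∀ s s' : Fin N × Fin N,
      μ (matchSet A k (s.1 * w) ((N + s.2) * w) ∩ matchSet A k (s'.1 * w) ((N + s'.2) * w)) ≤
        ∑' p, K * (μ (V p s.1 s'.1) * μ (V p s.2 s'.2)) := by
    intro s s'
    have hsub : matchSet A k (s.1 * w) ((N + s.2) * w) ∩
        matchSet A k (s'.1 * w) ((N + s'.2) * w) ⊆
        ⋃ p, V p s.1 s'.1 ∩ (shift A)^[N * w] ⁻¹' V p s.2 s'.2 := by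
      rintro x ⟨hx, hx'⟩
      obtain ⟨C, hC, h1, h2⟩ := mem_matchSet_iff.1 hx
      obtain ⟨D, hD, h3, h4⟩ := mem_matchSet_iff.1 hx'
      refine Set.mem_iUnion.2 ⟨(⟨C, hC⟩, ⟨D, hD⟩), ⟨h1, h3⟩, ?_, ?_⟩
      · rw [Set.mem_preimage, ← Function.iterate_add_apply, ← add_mul, add_comm]
        exact h2
      · rw [Set.mem_preimage, ← Function.iterate_add_apply, ← add_mul, add_comm]
        exact h4
    refine (measure_mono hsub).trans ((measure_iUnion_le _).trans ?_)
    exact ENNReal.tsum_le_tsum fun p => h.measure_inter_le le_rfl (hV p _ _) (hV p _ _)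
  have hW : ∀ p : cylinders A k × cylinders A k, ∑ a, ∑ a', μ (V p a a') ≤
      N * (if p.1 = p.2 then μ (p.1 : Set (ShiftSpace A)) else 0) +
        N ^ 2 * (K * (μ (p.1 : Set (ShiftSpace A)) * μ (p.2 : Set (ShiftSpace A)))) := by
    intro p
    have hle : ∑ a, ∑ a', μ (V p a a') ≤ ∑ a : Fin N, ∑ a' : Fin N,
        ((if (a : ℕ) = a' then (if p.1 = p.2 then μ (p.1 : Set (ShiftSpace A)) else 0) else 0) +
          K * (μ (p.1 : Set (ShiftSpace A)) * μ (p.2 : Set (ShiftSpace A)))) :=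
      Finset.sum_le_sum fun a _ => Finset.sum_le_sum fun a' _ =>
        h.measure_two_words_le hkw a a' p.1 p.2
    refine hle.trans (le_of_eq ?_)
    simp only [Finset.sum_add_distrib, Fin.val_inj, Finset.sum_ite_eq, Finset.mem_univ, if_true,
      Finset.sum_const, Finset.card_univ, Fintype.card_fin, nsmul_eq_mul]
    ring
  set Z := collision μ k with hZ
  calc _ ≤ ∑ s : Fin N × Fin N, ∑ s' : Fin N × Fin N,
          ∑' p, K * (μ (V p s.1 s'.1) * μ (V p s.2 s'.2)) :=
        Finset.sum_le_sum fun s _ => Finset.sum_le_sum fun s' _ => hpair s s'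
    _ = ∑' p, ∑ s : Fin N × Fin N, ∑ s' : Fin N × Fin N,
          K * (μ (V p s.1 s'.1) * μ (V p s.2 s'.2)) := by
        rw [Summable.tsum_finsetSum fun _ _ => ENNReal.summable]
        refine Finset.sum_congr rfl fun s _ => ?_
        rw [Summable.tsum_finsetSum fun _ _ => ENNReal.summable]
    _ = ∑' p, K * (∑ a, ∑ a', μ (V p a a')) ^ 2 := by
        refine tsum_congr fun p => ?_
        simp only [← Finset.mul_sum, Fintype.sum_prod_type, sq]
        congr 1
        rw [Finset.sum_mul_sum]
        refine Finset.sum_congr rfl fun a _ => Finset.sum_congr rfl fun b _ => ?_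
        rw [Finset.sum_mul_sum]
        simp only [Finset.mul_sum]
    _ ≤ ∑' p : cylinders A k × cylinders A k,
          (4 * K * N ^ 2 * (if p.1 = p.2 then μ (p.1 : Set (ShiftSpace A)) ^ 2 else 0) +
          4 * K ^ 3 * N ^ 4 *
            (μ (p.1 : Set (ShiftSpace A)) ^ 2 * μ (p.2 : Set (ShiftSpace A)) ^ 2)) := by
        refine ENNReal.tsum_le_tsum fun p => ?_
        calc _ ≤ K * _ := mul_le_mul' le_rfl ((pow_le_pow_left' (hW p) 2).trans
              (add_sq_le_four_mul _ _))
          _ = _ := by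
            split_ifs <;> ring
    _ = 4 * K * N ^ 2 * Z + 4 * K ^ 3 * N ^ 4 * (Z * Z) := by
        rw [ENNReal.tsum_add, ENNReal.tsum_mul_left, ENNReal.tsum_mul_left, ENNReal.tsum_prod',
          ENNReal.tsum_prod']
        congr 2
        · exact tsum_congr fun C => (tsum_eq_single C fun D hD => if_neg (Ne.symm hD)).trans
            (if_pos rfl)
        · simp_rw [ENNReal.tsum_mul_left, ENNReal.tsum_mul_right]
          rfl
    _ ≤ 4 * K ^ 3 * (N ^ 2 * Z) ^ 2 + 4 * K ^ 3 * (N ^ 2 * Z) ^ 2 := by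
        have hq : (N : ℝ≥0∞) ^ 2 * Z ≤ (N ^ 2 * Z) ^ 2 := by
          rw [sq ((N : ℝ≥0∞) ^ 2 * Z)]
          exact le_mul_of_one_le_left zero_le hN
        have hK3 : K ≤ K ^ 3 := le_self_pow₀ h.one_le (by norm_num)
        refine add_le_add ?_ (le_of_eq (by ring))
        rw [mul_assoc (4 * K)]
        gcongr
    _ = _ := by ring

/-- With probability bounded below, one of `N` early words of length `k` coincides with one
of `N` late ones, as soon as `N² ∑ μ(C)² ≥ 1`. -/
theorem le_measureReal_match (h : QuasiBernoulli μ K) {g : ℕ} {L : ℝ≥0∞} (hL : L ≠ ∞)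
    (hL1 : 1 ≤ L)
    (hgap : ∀ m n p : ℕ, m + g ≤ p → ∀ B E : Set (ShiftSpace A),
      DeterminedBy m B → DeterminedBy n E → μ B * μ E ≤ L * μ (B ∩ (shift A)^[p] ⁻¹' E))
    {k w N : ℕ} (hkw : k + g ≤ w) (hN : 1 ≤ (N : ℝ≥0∞) ^ 2 * collision μ k) :
    (8 * K.toReal ^ 3 * L.toReal ^ 2)⁻¹ ≤
      μ.real (⋃ s : Fin N × Fin N, matchSet A k (s.1 * w) ((N + s.2) * w)) := by
  have := h.isProbabilityMeasure
  set q : ℝ := (N : ℝ) ^ 2 * (collision μ k).toReal with hq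
  have hqE : ((N : ℝ≥0∞) ^ 2 * collision μ k).toReal = q := by
    simp [hq, ENNReal.toReal_mul]
  have hqtop : (N : ℝ≥0∞) ^ 2 * collision μ k ≠ ∞ :=
    ENNReal.mul_ne_top (ENNReal.pow_ne_top (ENNReal.natCast_ne_top N)) (collision_ne_top k)
  have hq1 : 1 ≤ q := by
    rw [← hqE]
    simpa using ENNReal.toReal_mono hqtop hN
  have hK1 : 1 ≤ K.toReal := by simpa using ENNReal.toReal_mono h.ne_top h.one_le
  have hLr : 1 ≤ L.toReal := by simpa using ENNReal.toReal_mono hL hL1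
  have hmeas : ∀ s : Fin N × Fin N,
      MeasurableSet (matchSet A k (s.1 * w) ((N + s.2) * w)) := fun s =>
    (determinedBy_matchSet (n := s.1 * w + (N + s.2) * w + k) (by omega)
      (by omega)).measurableSet
  have hfirst : q / L.toReal ≤
      ∑ s : Fin N × Fin N, μ.real (matchSet A k (s.1 * w) ((N + s.2) * w)) := by
    have h1 : ∀ s : Fin N × Fin N, (collision μ k).toReal / L.toReal ≤
        μ.real (matchSet A k (s.1 * w) ((N + s.2) * w)) := by
      intro s
      have hle : s.1 * w + k + g ≤ (N + s.2) * w := by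
        have := s.1.2
        have h2 : (s.1 + 1) * w ≤ (N + s.2) * w := Nat.mul_le_mul_right w (by omega)
        rw [add_mul, one_mul] at h2
        omega
      have h3 : collision μ k ≤ L * μ (matchSet A k (s.1 * w) ((N + s.2) * w)) := by
        rw [measure_matchSet_eq_tsum, collision, ← ENNReal.tsum_mul_left]
        refine ENNReal.tsum_le_tsum fun C => ?_
        have h4 := hgap _ k _ hle _ _ ((DeterminedBy.of_mem_cylinders C.2).preimage (s.1 * w))
          (DeterminedBy.of_mem_cylinders C.2)
        rwa [measure_preimage_iterate h.invariant _ (measurableSet_of_mem_cylinders C.2),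
          ← sq] at h4
      have h5 := ENNReal.toReal_mono (ENNReal.mul_ne_top hL (measure_ne_top _ _)) h3
      rw [ENNReal.toReal_mul] at h5
      rw [div_le_iff₀ (by linarith), mul_comm]
      exact h5
    calc q / L.toReal = ∑ s : Fin N × Fin N, (collision μ k).toReal / L.toReal := by
          rw [Finset.sum_const, Finset.card_univ, Fintype.card_prod, Fintype.card_fin,
            nsmul_eq_mul, hq]
          push_cast
          ring
      _ ≤ _ := Finset.sum_le_sum fun s _ => h1 s
  have hsecond : ∑ s : Fin N × Fin N, ∑ s' : Fin N × Fin N,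
      μ.real (matchSet A k (s.1 * w) ((N + s.2) * w) ∩
        matchSet A k (s'.1 * w) ((N + s'.2) * w)) ≤ 8 * K.toReal ^ 3 * q ^ 2 := by
    have h1 := h.sum_measure_matchSet_inter_le (by omega : k ≤ w) hN
    have h2 := ENNReal.toReal_mono (ENNReal.mul_ne_top (ENNReal.mul_ne_top (by norm_num)
      (ENNReal.pow_ne_top h.ne_top)) (ENNReal.pow_ne_top hqtop)) h1
    rw [ENNReal.toReal_sum fun s _ => ENNReal.sum_ne_top.2 fun s' _ => measure_ne_top _ _,
      ENNReal.toReal_mul, ENNReal.toReal_mul, ENNReal.toReal_pow, ENNReal.toReal_pow, hqE] at h2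
    refine le_trans (le_of_eq (Finset.sum_congr rfl fun s _ => ?_)) (h2.trans (by norm_num))
    rw [ENNReal.toReal_sum fun s' _ => measure_ne_top _ _]
    rfl
  -- the optimal `t` for these two moment bounds
  set t : ℝ := (8 * K.toReal ^ 3 * L.toReal * q)⁻¹ with ht
  have ht0 : 0 < t := by positivity
  refine le_trans ?_ (second_moment_le_measureReal_iUnion hmeas t)
  calc (8 * K.toReal ^ 3 * L.toReal ^ 2)⁻¹
      = 2 * t * (q / L.toReal) - t ^ 2 * (8 * K.toReal ^ 3 * q ^ 2) := by
        rw [ht]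
        field_simp
        ring
    _ ≤ _ := by gcongr

/-- The probability that an event of probability at least `θ` fails in `R` consecutive blocks
separated by gaps decays exponentially in `R`. -/
theorem measureReal_blocks_le (h : QuasiBernoulli μ K) {g : ℕ} {L : ℝ≥0∞} (hL : L ≠ ∞)
    (hL1 : 1 ≤ L)
    (hgap : ∀ m n p : ℕ, m + g ≤ p → ∀ B E : Set (ShiftSpace A),
      DeterminedBy m B → DeterminedBy n E → μ B * μ E ≤ L * μ (B ∩ (shift A)^[p] ⁻¹' E))
    {l : ℕ} {D : Set (ShiftSpace A)} (hD : DeterminedBy l D) {θ : ℝ} (hθ : θ ≤ μ.real D)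
    (R : ℕ) :
    μ.real {x | ∀ r < R, (shift A)^[r * (l + g)] x ∉ D} ≤ (1 - θ / L.toReal) ^ R := by
  have := h.isProbabilityMeasure
  have hLr : 1 ≤ L.toReal := by simpa using ENNReal.toReal_mono hL hL1
  set F : ℕ → Set (ShiftSpace A) := fun R => {x | ∀ r < R, (shift A)^[r * (l + g)] x ∉ D} with hF
  have hθ1 : 0 ≤ 1 - θ / L.toReal := by
    have h1 : θ ≤ 1 := hθ.trans measureReal_le_one
    have : θ / L.toReal ≤ 1 := (div_le_one (by linarith)).2 (h1.trans hLr)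
    linarith
  have hdet : ∀ R, DeterminedBy (R * (l + g)) (F R) := by
    intro R x y hxy hx r hr hyD
    refine hx r hr (hD _ _ (fun i hi => ?_) hyD)
    rw [shift_iterate_apply, shift_iterate_apply, hxy]
    have : (r + 1) * (l + g) ≤ R * (l + g) := Nat.mul_le_mul_right _ hr
    rw [add_mul, one_mul] at this
    omega
  change μ.real (F R) ≤ _
  induction R with
  | zero => simp
  | succ R ih =>
    -- the first block is split off, and the others form the shifted event `G`
    set G := (shift A)^[l + g] ⁻¹' F R with hG
    have hGm : MeasurableSet G := ((hdet R).preimage _).measurableSet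
    have hGF : μ.real G = μ.real (F R) := by
      rw [measureReal_def, hG, measure_preimage_iterate h.invariant _ (hdet R).measurableSet]
      rfl
    have hsub : F (R + 1) ⊆ G \ (D ∩ G) := by
      refine fun x hx => ⟨fun r hr => ?_, fun hx' => hx 0 (by omega) (by simpa using hx'.1)⟩
      rw [← Function.iterate_add_apply, ← Nat.succ_mul]
      exact hx (r + 1) (by omega)
    have hlow : θ / L.toReal * μ.real (F R) ≤ μ.real (D ∩ G) := by
      have h1 := ENNReal.toReal_mono (ENNReal.mul_ne_top hL (measure_ne_top _ _))
        (hgap l _ (l + g) le_rfl D (F R) hD (hdet R))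
      rw [ENNReal.toReal_mul, ENNReal.toReal_mul] at h1
      rw [div_mul_eq_mul_div, div_le_iff₀ (by linarith), mul_comm _ L.toReal]
      exact (mul_le_mul_of_nonneg_right hθ measureReal_nonneg).trans h1
    calc μ.real (F (R + 1)) ≤ μ.real (G \ (D ∩ G)) := measureReal_mono hsub
      _ = μ.real G - μ.real (D ∩ G) :=
        measureReal_sdiff Set.inter_subset_right (hD.measurableSet.inter hGm)
      _ ≤ μ.real (F R) - θ / L.toReal * μ.real (F R) := by rw [hGF]; gcongr
      _ = μ.real (F R) * (1 - θ / L.toReal) := by ring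
      _ ≤ (1 - θ / L.toReal) ^ R * (1 - θ / L.toReal) := by gcongr
      _ = _ := (pow_succ _ _).symm

/-- Lower bound: almost surely there is eventually a repetition of length `k` among the
first `exp (a k / 2)` positions, for `a > H₂(μ)`. -/
theorem ae_eventually_mem_repeatLengths (h : QuasiBernoulli μ K) (hA : TopologicallyMixing A)
    {H : ℝ} (hH : HasRenyiEntropy μ H) (hH0 : 0 < H) {a : ℝ} (haH : H < a) :
    ∀ᵐ x ∂μ, ∀ᶠ k : ℕ in atTop, k ∈ repeatLengths x ⌈Real.exp (a * k / 2)⌉₊ := by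
  have := h.isProbabilityMeasure
  obtain ⟨g, L, hL, hL1, hgap⟩ := h.exists_gap hA
  obtain ⟨b, hHb, hba⟩ := exists_between haH
  have hZ := hH.eventually_ge h.collisionSum_pos hHb
  have hK1 : 1 ≤ K.toReal := by simpa using ENNReal.toReal_mono h.ne_top h.one_le
  have hLr : 1 ≤ L.toReal := by simpa using ENNReal.toReal_mono hL hL1
  set θ : ℝ := (8 * K.toReal ^ 3 * L.toReal ^ 2)⁻¹ with hθ
  have hθ0 : 0 < θ := by positivity
  have hθ1 : θ ≤ 1 := by
    refine inv_le_one_of_one_le₀ ?_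
    have h1 : 1 ≤ K.toReal ^ 3 := one_le_pow₀ hK1
    have h2 : 1 ≤ L.toReal ^ 2 := one_le_pow₀ hLr
    nlinarith
  have hr0 : 0 ≤ 1 - θ / L.toReal := by
    have : θ / L.toReal ≤ 1 := (div_le_one (by linarith)).2 (hθ1.trans hLr)
    linarith
  have hr1 : 1 - θ / L.toReal < 1 := by
    have : 0 < θ / L.toReal := by positivity
    linarith
  -- `k` blocks, of length `2 N (k + g)` and separated by gaps `g`, fit into the time interval
  have hroom : ∀ᶠ k : ℕ in atTop,
      k * (2 * ⌈Real.exp (b * k / 2)⌉₊ * (k + g) + g) ≤ ⌈Real.exp (a * k / 2)⌉₊ := by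
    set c := (a - b) / 2 with hc
    have hc0 : 0 < c := by linarith
    have h0 : Tendsto (fun k : ℕ => (k : ℝ) ^ 2 * Real.exp (-(c * k))) atTop (𝓝 0) := by
      have h1 : Summable fun k : ℕ => (k : ℝ) ^ 2 * Real.exp (-c * k) :=
        Real.summable_pow_mul_exp_neg_nat_mul 2 hc0
      simpa [neg_mul] using h1.tendsto_atTop_zero
    filter_upwards [h0.eventually (gt_mem_nhds (show (0 : ℝ) < 1 / 10 by norm_num)),
      eventually_ge_atTop (max g 1)] with k hk hkg
    have hkg' : (g : ℝ) ≤ k := by exact_mod_cast (le_max_left g 1).trans hkg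
    have hk1 : (1 : ℝ) ≤ k := by exact_mod_cast (le_max_right g 1).trans hkg
    have hb0 : 0 ≤ b * k / 2 := by
      have : 0 < b := hH0.trans hHb
      positivity
    have hE1 : 1 ≤ Real.exp (b * k / 2) := Real.one_le_exp hb0
    have hceil : (⌈Real.exp (b * k / 2)⌉₊ : ℝ) ≤ 2 * Real.exp (b * k / 2) := by
      have := Nat.ceil_lt_add_one (Real.exp_pos (b * k / 2)).le
      linarith
    have hmain : (k : ℝ) * (2 * ⌈Real.exp (b * k / 2)⌉₊ * (k + g) + g) ≤
        Real.exp (a * k / 2) := by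
      calc (k : ℝ) * (2 * ⌈Real.exp (b * k / 2)⌉₊ * (k + g) + g)
          ≤ k * (2 * (2 * Real.exp (b * k / 2)) * (k + k) + k * Real.exp (b * k / 2)) := by
            gcongr
            exact hkg'.trans (le_mul_of_one_le_right (by linarith) hE1)
        _ = 9 * (k : ℝ) ^ 2 * Real.exp (b * k / 2) := by ring
        _ = 9 * ((k : ℝ) ^ 2 * Real.exp (-(c * k))) * Real.exp (a * k / 2) := by
            rw [show b * k / 2 = -(c * k) + a * k / 2 by rw [hc]; ring, Real.exp_add]
            ring
        _ ≤ 1 * Real.exp (a * k / 2) := by gcongr; linarith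
        _ = _ := one_mul _
    have := hmain.trans (Nat.le_ceil _)
    exact_mod_cast this
  have hae := ae_eventually_notMem_of_summable (μ := μ)
    (s := fun k : ℕ => {x | k ∉ repeatLengths x ⌈Real.exp (a * k / 2)⌉₊})
    (summable_geometric_of_lt_one hr0 hr1) ?_
  · filter_upwards [hae] with x hx
    filter_upwards [hx] with k hk
    exact not_not.1 hk
  filter_upwards [hZ, hroom, eventually_gt_atTop 0] with k hk hk' hk0
  -- the least `N` for which `Z_k ≥ exp (-b k)` guarantees `N² Z_k ≥ 1`
  set N := ⌈Real.exp (b * k / 2)⌉₊ with hN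
  have hNZ : 1 ≤ (N : ℝ≥0∞) ^ 2 * collision μ k := by
    have h1 : 1 ≤ (N : ℝ) ^ 2 * collisionSum μ k := by
      calc (1 : ℝ) = Real.exp (b * k / 2) ^ 2 * Real.exp (-(b * k)) := by
            rw [← Real.exp_nat_mul, ← Real.exp_add, ← Real.exp_zero]
            congr 1
            push_cast
            ring
        _ ≤ _ := by
            gcongr
            exact Nat.le_ceil _
    have h2 := ENNReal.ofReal_le_ofReal h1
    rwa [ENNReal.ofReal_one, ENNReal.ofReal_mul (by positivity), collisionSum_eq_toReal,
      ENNReal.ofReal_toReal (collision_ne_top k), ENNReal.ofReal_pow (by positivity),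
      ENNReal.ofReal_natCast] at h2
  set D := ⋃ s : Fin N × Fin N, matchSet A k (s.1 * (k + g)) ((N + s.2) * (k + g)) with hD
  have hend : ∀ s : Fin N × Fin N, (N + s.2) * (k + g) + k ≤ 2 * N * (k + g) := by
    intro s
    have h1 : (N + s.2 + 1) * (k + g) ≤ 2 * N * (k + g) := Nat.mul_le_mul_right _ (by omega)
    rw [Nat.succ_mul] at h1
    omega
  have hlt : ∀ s : Fin N × Fin N, s.1 * (k + g) < (N + s.2) * (k + g) := fun s =>
    Nat.mul_lt_mul_of_pos_right (by omega) (by omega)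
  have hDdet : DeterminedBy (2 * N * (k + g)) D := by
    intro x y hxy hx
    obtain ⟨s, hs⟩ := Set.mem_iUnion.1 hx
    refine Set.mem_iUnion.2 ⟨s, determinedBy_matchSet ?_ (hend s) x y hxy hs⟩
    have h1 := hlt s
    have h2 := hend s
    omega
  have hDθ : θ ≤ μ.real D := h.le_measureReal_match hL hL1 hgap le_rfl hNZ
  refine le_trans (measureReal_mono ?_) (h.measureReal_blocks_le hL hL1 hgap hDdet hDθ k)
  intro x hx r hr hxD
  refine hx ?_
  obtain ⟨s, hs⟩ := Set.mem_iUnion.1 hxD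
  refine ⟨r * (2 * N * (k + g) + g) + s.1 * (k + g),
    r * (2 * N * (k + g) + g) + (N + s.2) * (k + g), ?_, ?_, fun i hi => ?_⟩
  · have := hlt s
    omega
  · have h1 : (r + 1) * (2 * N * (k + g) + g) ≤ k * (2 * N * (k + g) + g) :=
      Nat.mul_le_mul_right _ hr
    rw [Nat.succ_mul] at h1
    have h2 := hend s
    omega
  · have := hs i hi
    rwa [shift_iterate_apply, shift_iterate_apply, ← add_assoc, ← add_assoc] at this

end QuasiBernoulli

/-! ### From exponential scales to the limit -/

theorem isGreatest_maxRepeat {x : ShiftSpace A} {n : ℕ} (hn : 2 ≤ n)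
    (hb : BddAbove (repeatLengths x n)) : IsGreatest (repeatLengths x n) (maxRepeat x n) := by
  have hne : (repeatLengths x n).Nonempty := ⟨0, 0, 1, by omega, by omega, by simp⟩
  exact ⟨Nat.sSup_mem hne hb, fun k hk => le_csSup hb hk⟩

/-- If repetitions of length `k` first appear between the times `exp (a k / 2)` and `exp (b k / 2)`
for large `k` and all rational `a < H < b`, then `M_n / log n → 2 / H`. The inverse relation is
read off at `k = ⌊2 log n / b⌋` and `k = ⌈2 log n / a⌉`. -/
theorem tendsto_maxRepeat_div_log {x : ShiftSpace A} {H : ℝ} (hH : 0 < H)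
    (hup : ∀ q : ℚ, 0 < (q : ℝ) → (q : ℝ) < H →
      ∀ᶠ k : ℕ in atTop, k ∉ repeatLengths x ⌊Real.exp (q * k / 2)⌋₊)
    (hlow : ∀ q : ℚ, H < (q : ℝ) →
      ∀ᶠ k : ℕ in atTop, k ∈ repeatLengths x ⌈Real.exp (q * k / 2)⌉₊) :
    (∀ n ≥ 2, IsGreatest (repeatLengths x n) (maxRepeat x n)) ∧
      Tendsto (fun n : ℕ => (maxRepeat x n : ℝ) / Real.log n) atTop (𝓝 (2 / H)) := by
  have hlog : Tendsto (fun n : ℕ => Real.log n) atTop atTop :=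
    Real.tendsto_log_atTop.comp tendsto_natCast_atTop_atTop
  -- the values of `k` for which `exp (a k / 2)` is comparable with `n`
  have hscale : ∀ a : ℝ, 0 < a → Tendsto (fun n : ℕ => 2 * Real.log n / a) atTop atTop :=
    fun a ha => (hlog.const_mul_atTop two_pos).atTop_div_const ha
  have hceil : ∀ q : ℚ, 0 < (q : ℝ) → (q : ℝ) < H → ∀ᶠ n : ℕ in atTop,
      ⌈2 * Real.log n / q⌉₊ ∉ repeatLengths x n := by
    intro q hq hqH
    filter_upwards [((tendsto_nat_ceil_atTop).comp (hscale q hq)).eventually (hup q hq hqH),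
      eventually_gt_atTop 0] with n hn hn0 hmem
    refine hn (repeatLengths_mono x ?_ hmem)
    refine Nat.le_floor ?_
    have hn0' : (0 : ℝ) < n := by exact_mod_cast hn0
    have := Nat.le_ceil (2 * Real.log n / q)
    rw [div_le_iff₀ hq] at this
    rw [← Real.log_le_iff_le_exp hn0']
    simp only [Function.comp_apply]
    linarith
  have hbdd : ∀ n, BddAbove (repeatLengths x n) := by
    intro n
    obtain ⟨q, hq, hqH⟩ := exists_rat_btwn hH
    obtain ⟨m, hm, hnm⟩ := ((hceil q hq hqH).and (eventually_ge_atTop n)).exists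
    refine ⟨⌈2 * Real.log m / q⌉₊, fun k hk => ?_⟩
    by_contra hlt
    exact hm (mem_repeatLengths_of_le (not_le.1 hlt).le (repeatLengths_mono x hnm hk))
  refine ⟨fun n hn => isGreatest_maxRepeat hn (hbdd n), ?_⟩
  have hinv : Tendsto (fun n : ℕ => (Real.log n)⁻¹) atTop (𝓝 0) := tendsto_inv_atTop_zero.comp hlog
  rw [tendsto_order]
  have hcont : ContinuousAt (fun b : ℝ => 2 / b) H := continuousAt_const.div continuousAt_id hH.ne'
  constructor
  · intro c hc
    obtain ⟨ε, hε, hball⟩ := Metric.eventually_nhds_iff.1 (hcont.eventually (lt_mem_nhds hc))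
    obtain ⟨q, hHq, hqε⟩ := exists_rat_btwn (show H < H + ε by linarith)
    have hq0 : (0 : ℝ) < q := hH.trans hHq
    have hcq : c < 2 / q := hball (by rw [Real.dist_eq, abs_lt]; constructor <;> linarith)
    have hfloor := ((tendsto_nat_floor_atTop).comp (hscale q hq0)).eventually (hlow q hHq)
    have hsmall := hinv.eventually (gt_mem_nhds (show 0 < 2 / (q : ℝ) - c by linarith))
    filter_upwards [hfloor, hsmall, hlog.eventually_gt_atTop 0, eventually_gt_atTop 0] with
      n h1 h2 h3 h4
    have hn0' : (0 : ℝ) < n := by exact_mod_cast h4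
    have hle : ⌈Real.exp (q * (⌊2 * Real.log n / q⌋₊ : ℕ) / 2)⌉₊ ≤ n := by
      refine Nat.ceil_le.2 ?_
      rw [← Real.le_log_iff_exp_le hn0']
      have := Nat.floor_le (a := 2 * Real.log n / q) (by positivity)
      rw [le_div_iff₀ hq0] at this
      linarith
    have hM : ⌊2 * Real.log n / q⌋₊ ≤ maxRepeat x n := le_csSup (hbdd n) (repeatLengths_mono x hle h1)
    have hM' : (⌊2 * Real.log n / q⌋₊ : ℝ) ≤ maxRepeat x n := by exact_mod_cast hM
    have hfl := Nat.lt_floor_add_one (2 * Real.log n / q)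
    rw [lt_div_iff₀ h3]
    have h5 := mul_lt_mul_of_pos_right h2 h3
    rw [inv_mul_cancel₀ h3.ne'] at h5
    have h6 : 2 * Real.log n / q = 2 / q * Real.log n := by ring
    rw [h6] at hfl hM'
    linarith
  · intro c hc
    obtain ⟨ε, hε, hball⟩ := Metric.eventually_nhds_iff.1 (hcont.eventually (gt_mem_nhds hc))
    obtain ⟨q, hHq, hqε⟩ := exists_rat_btwn (show max 0 (H - ε) < H by simp [hH, hε])
    have hq0 : (0 : ℝ) < q := (le_max_left _ _).trans_lt hHq
    have hq1 : H - ε < q := (le_max_right _ _).trans_lt hHq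
    have hcq : 2 / q < c := hball (by rw [Real.dist_eq, abs_lt]; constructor <;> linarith)
    have hsmall := hinv.eventually (gt_mem_nhds (show 0 < c - 2 / (q : ℝ) by linarith))
    filter_upwards [hceil q hq0 hqε, hsmall, hlog.eventually_gt_atTop 0,
      eventually_ge_atTop 2] with n h1 h2 h3 h4
    have hmem := (isGreatest_maxRepeat h4 (hbdd n)).1
    have hM : maxRepeat x n < ⌈2 * Real.log n / q⌉₊ := by
      by_contra hlt
      exact h1 (mem_repeatLengths_of_le (not_lt.1 hlt) hmem)
    have hM' : (maxRepeat x n : ℝ) < ⌈2 * Real.log n / q⌉₊ := by exact_mod_cast hM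
    have hcl := Nat.ceil_lt_add_one (a := 2 * Real.log n / q) (by positivity)
    rw [div_lt_iff₀ h3]
    have h5 := mul_lt_mul_of_pos_right h2 h3
    rw [inv_mul_cancel₀ h3.ne'] at h5
    have h6 : 2 * Real.log n / q = 2 / q * Real.log n := by ring
    rw [h6] at hcl hM'
    linarith

end MarkovShift

theorem theorem1p1 {I : Type*} [Countable I] [Nontrivial I] (A : Matrix I I (Fin 2))
    (hA : MarkovShift.TopologicallyMixing A)
    (φ : MarkovShift.ShiftSpace A → ℝ) (hφ : MarkovShift.LocallyHolder φ)
    (μ : Measure (MarkovShift.ShiftSpace A)) (hμ : MarkovShift.IsGibbs φ μ) :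
    ∃ H : ℝ, 0 < H ∧ MarkovShift.HasRenyiEntropy μ H ∧
      ∀ᵐ x ∂μ,
        (∀ n ≥ 2, IsGreatest (MarkovShift.repeatLengths x n) (MarkovShift.maxRepeat x n)) ∧
        Tendsto (fun n : ℕ => (MarkovShift.maxRepeat x n : ℝ) / Real.log n) atTop
          (𝓝 (2 / H)) := by
  obtain ⟨K, h⟩ := hμ.exists_quasiBernoulli
  obtain ⟨H, hH0, hH⟩ := h.exists_renyiEntropy hA
  refine ⟨H, hH0, hH, ?_⟩
  have hup : ∀ᵐ x ∂μ, ∀ q : ℚ, 0 < (q : ℝ) → (q : ℝ) < H →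
      ∀ᶠ k : ℕ in atTop, k ∉ MarkovShift.repeatLengths x ⌊Real.exp (q * k / 2)⌋₊ := by
    refine ae_all_iff.2 fun q => ?_
    by_cases hq : 0 < (q : ℝ) ∧ (q : ℝ) < H
    · filter_upwards [h.ae_eventually_notMem_repeatLengths hH hq.1 hq.2] with x hx _ _ using hx
    · exact ae_of_all _ fun x h0 h1 => absurd ⟨h0, h1⟩ hq
  have hlow : ∀ᵐ x ∂μ, ∀ q : ℚ, H < (q : ℝ) →
      ∀ᶠ k : ℕ in atTop, k ∈ MarkovShift.repeatLengths x ⌈Real.exp (q * k / 2)⌉₊ := by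
    refine ae_all_iff.2 fun q => ?_
    by_cases hq : H < (q : ℝ)
    · filter_upwards [h.ae_eventually_mem_repeatLengths hA hH hH0 hq] with x hx _ using hx
    · exact ae_of_all _ fun x h0 => absurd h0 hq
  filter_upwards [hup, hlow] with x h1 h2
  exact MarkovShift.tendsto_maxRepeat_div_log hH0 h1 h2
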